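/- Let $d\ge 2$, let $\Omega\subset\mathbb{R}^d$ be a bounded convex domain with $C^2$ boundary and unit outward normal $n$, and let $\mathbf{v}=(v_1,\dots,v_d)\in C^2(\overline{\Omega},\mathbb{R}^d)$ satisfy $\mathbf{v}\cdot n=0$ on $\partial\Omega$. Set $g=|\mathbf{v}|^2$ and $\operatorname{div}\mathbf{v}=\sum_i \frac{\partial v_i}{\partial x_i}$, write $\{g=t\}=\{x\in\Omega: g(x)=t\}$ and $\{g>t\}=\{x\in\Omega: g(x)>t\}$, and let $\sigma=H^{d-1}$ be the $(d-1)$-dimensional Hausdorff measure, normalized to agree with the usual surface area. Then for a.e. $t\in(0,\infty)$ all the integrals below converge absolutely and $$ \int_{\{g=t\}}|\nabla g|\,d\sigma\;\le\; 2\sqrt t\int_{\{g=t\}}\Big\{\Big(\sum_{i,j=1}^d\Big|\frac{\partial v_i}{\partial x_j}-\frac{\partial v_j}{\partial x_i}\Big|^2\Big)^{1/2}+|\operatorname{div}\mathbf{v}|\Big\}\,d\sigma +2\int_{\{g>t\}}\Big\{|\operatorname{div}\mathbf{v}|^2-\sum_{i,j=1}^d\frac{\partial v_i}{\partial x_j}\frac{\partial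 v_j}{\partial x_i}\Big\}\,dx . $$ -/

import Mathlib

open scoped MeasureTheory

/-- `ρ` is a `C²` defining function of `Ω` on the open neighbourhood `U` of `p`:
inside `U`, the set `Ω` is exactly where `ρ` is negative, and `∇ρ(p) ≠ 0`. -/
structure IsC2DefiningFunction {d : ℕ} (Ω : Set (EuclideanSpace ℝ (Fin d)))
    (p : EuclideanSpace ℝ (Fin d)) (U : Set (EuclideanSpace ℝ (Fin d)))
    (ρ : EuclideanSpace ℝ (Fin d) → ℝ) : Prop where
  isOpen : IsOpen U
  mem : p ∈ U
  contDiffOn : ContDiffOn ℝ 2 ρ U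
  inter_eq : Ω ∩ U = {x ∈ U | ρ x < 0}
  gradient_ne_zero : gradient ρ p ≠ 0

/-- `Ω` has `C²` boundary: near each boundary point it has a `C²` defining function
(equivalently, by the implicit function theorem, `Ω` is locally the region on one side
of the graph of a `C²` function, in suitable orthonormal coordinates). -/
def HasC2Boundary {d : ℕ} (Ω : Set (EuclideanSpace ℝ (Fin d))) : Prop :=
  ∀ p ∈ frontier Ω, ∃ U ρ, IsC2DefiningFunction Ω p U ρ

/-- `n` is the unit outward normal to `Ω` at the boundary point `p`, that is
`n = ∇ρ(p) / |∇ρ(p)|` for a local defining function `ρ` (negative inside `Ω`). -/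
def IsUnitOutwardNormal {d : ℕ} (Ω : Set (EuclideanSpace ℝ (Fin d)))
    (p n : EuclideanSpace ℝ (Fin d)) : Prop :=
  ∃ U ρ, IsC2DefiningFunction Ω p U ρ ∧ n = ‖gradient ρ p‖⁻¹ • gradient ρ p

/-- The partial derivative `∂vᵢ/∂xⱼ` at `x`. -/
noncomputable def partialD {d : ℕ} (v : EuclideanSpace ℝ (Fin d) → EuclideanSpace ℝ (Fin d))
    (i j : Fin d) (x : EuclideanSpace ℝ (Fin d)) : ℝ :=
  fderiv ℝ (fun y => v y i) x (EuclideanSpace.single j 1)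

/-- The divergence `∑ᵢ ∂vᵢ/∂xᵢ`. -/
noncomputable def divergence {d : ℕ} (v : EuclideanSpace ℝ (Fin d) → EuclideanSpace ℝ (Fin d))
    (x : EuclideanSpace ℝ (Fin d)) : ℝ :=
  ∑ i, partialD v i i x

/-- The size of the curl, `(∑ᵢⱼ |∂vᵢ/∂xⱼ - ∂vⱼ/∂xᵢ|²)^{1/2}`. -/
noncomputable def curlNorm {d : ℕ} (v : EuclideanSpace ℝ (Fin d) → EuclideanSpace ℝ (Fin d))
    (x : EuclideanSpace ℝ (Fin d)) : ℝ :=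
  √(∑ i, ∑ j, |partialD v i j x - partialD v j i x| ^ 2)

section LevelSets

open MeasureTheory Set Filter Topology
open scoped ENNReal NNReal

/-! Consider the field `w = Dv v - (div v) v`. Second derivatives cancel in its divergence, leaving
`div w = ∑ ∂ⱼvᵢ ∂ᵢvⱼ - (div v)² = -q`, where `q` is the integrand over the superlevel sets. On the
boundary `v` is tangent, so `w · n = (Dv v) · n`; this is minus the second fundamental form at `(v,
v)`, hence nonpositive by convexity.

Let `ψ ≥ 0` be continuous and `Φ(r) = ∫₀ʳ ψ`. The field `Φ(g) w` does not point outwards either, so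
the integral of its divergence `ψ(g) ∇g · w + Φ(g) div w` over `Ω` is at most zero
(`energy_inequality`). Moreover `∇g / 2 = (Dv)ᵀ v` differs from `Dv v` by the antisymmetric part of
`Dv` acting on `v`, so Cauchy–Schwarz gives `2 ∇g · w ≥ |∇g|² - 2 √g (curlNorm v + |div v|) |∇g|`
(`gradient_norm_sq_estimate`). Together, `∫ ψ(g) |∇g|² ≤ ∫ ψ(g) 2 √g (curlNorm v + |div v|) |∇g| + 2
∫ Φ(g) q`.

The coarea formula turns the integrals with a factor `|∇g|` into integrals of `ψ(t)` against
level-set integrals, and the layer-cake formula turns the last one into an integral of `ψ(t)`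
against superlevel integrals (`level_integral`, `superlevel_integral`). Since `ψ` is arbitrary, the
inequality holds for a.e. `t`.

Three tools carry the analysis. The coarea formula on the regular set (`coarea_lintegral`) comes
from Fubini for hyperplane slices and maps that straighten the level sets with bi-Lipschitz constant
close to 1. A Sard-type covering argument makes the critical points negligible on a.e. level. A
one-sided divergence theorem (`setIntegral_divergence_nonpos`) uses a cutoff built from the gauge of
`Ω` and so needs no surface integral. -/

/-! ### Fubini for slices by parallel hyperplanes. -/

theorem slice_zero_eq_image {m : ℕ} (B : Set (EuclideanSpace ℝ (Fin (m + 1)))) (s : ℝ) :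
    B ∩ {z | z 0 = s} =
      (fun y : EuclideanSpace ℝ (Fin m) => WithLp.toLp 2 (Fin.cons s y.ofLp : Fin (m + 1) → ℝ)) ''
        ((fun y : EuclideanSpace ℝ (Fin m) =>
          WithLp.toLp 2 (Fin.cons s y.ofLp : Fin (m + 1) → ℝ)) ⁻¹' B) := by
  ext z
  constructor
  · rintro ⟨hz, hs⟩
    refine ⟨WithLp.toLp 2 (Fin.tail z.ofLp), ?_, ?_⟩
    · have : WithLp.toLp 2 (Fin.cons s (Fin.tail z.ofLp) : Fin (m + 1) → ℝ) = z := by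
        rw [← (show z.ofLp 0 = s from hs), Fin.cons_self_tail]
      simpa [this] using hz
    · simp only
      rw [← (show z.ofLp 0 = s from hs), Fin.cons_self_tail]
  · rintro ⟨y, hy, rfl⟩
    exact ⟨hy, by simp⟩

theorem isometry_cons {m : ℕ} (s : ℝ) :
    Isometry (fun y : EuclideanSpace ℝ (Fin m) =>
      (WithLp.toLp 2 (Fin.cons s y.ofLp : Fin (m + 1) → ℝ) : EuclideanSpace ℝ (Fin (m + 1)))) := by
  refine Isometry.of_dist_eq fun x y => ?_
  simp [EuclideanSpace.dist_eq, Fin.sum_univ_succ]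

/-- Slices become sections of a subset of a product, the form to which Tonelli's theorem applies. -/
theorem slice_zero_eq_volume {m : ℕ} (B : Set (EuclideanSpace ℝ (Fin (m + 1))))
    (s : ℝ) :
    μHE[m] (B ∩ {z | z 0 = s}) =
      (volume : Measure (Fin m → ℝ)) (Prod.mk s ⁻¹'
        ((MeasurableEquiv.piFinSuccAbove (fun _ : Fin (m + 1) => ℝ) 0).symm ⁻¹'
          (WithLp.toLp 2 ⁻¹' B))) := by
  rw [slice_zero_eq_image, (isometry_cons s).euclideanHausdorffMeasure_image,
    EuclideanSpace.euclideanHausdorffMeasure_eq_volume,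
    ← (EuclideanSpace.volume_preserving_symm_measurableEquiv_toLp (Fin m)).symm.measure_preimage_equiv]
  congr 1
  ext y
  simp [MeasurableEquiv.piFinSuccAbove, Fin.insertNthEquiv]

theorem slice_zero_measurable {m : ℕ} (B : Set (EuclideanSpace ℝ (Fin (m + 1))))
    (hB : MeasurableSet B) :
    Measurable (fun s : ℝ => μHE[m] (B ∩ {z | z 0 = s})) := by
  simp_rw [slice_zero_eq_volume B]
  apply measurable_measure_prodMk_left
  exact (MeasurableEquiv.measurable _) ((WithLp.measurable_toLp 2 _) hB)

theorem lintegral_slice_zero {m : ℕ} (B : Set (EuclideanSpace ℝ (Fin (m + 1))))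
    (hB : MeasurableSet B) :
    ∫⁻ s : ℝ, μHE[m] (B ∩ {z | z 0 = s}) = volume B := by
  simp_rw [slice_zero_eq_volume B]
  have hB' : MeasurableSet (WithLp.toLp 2 ⁻¹' B : Set (Fin (m + 1) → ℝ)) :=
    (WithLp.measurable_toLp 2 _) hB
  rw [← Measure.prod_apply ((MeasurableEquiv.measurable _) hB')]
  have h1 := (volume_preserving_piFinSuccAbove (fun _ : Fin (m + 1) => ℝ) 0).symm
  have h2 := (EuclideanSpace.volume_preserving_symm_measurableEquiv_toLp (Fin (m + 1))).symm
  rw [← Measure.volume_eq_prod]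
  erw [h1.measure_preimage hB'.nullMeasurableSet]
  exact h2.measure_preimage hB.nullMeasurableSet

/-- Completing `e` to an orthonormal basis reduces slices orthogonal to `e` to coordinate slices. -/
theorem exists_isometry_slice {m : ℕ} (e : EuclideanSpace ℝ (Fin (m + 1))) (he : ‖e‖ = 1) :
    ∃ L : EuclideanSpace ℝ (Fin (m + 1)) ≃ₗᵢ[ℝ] EuclideanSpace ℝ (Fin (m + 1)),
      ∀ z, L z 0 = inner ℝ e z := by
  have ho : Orthonormal ℝ (({0} : Set (Fin (m + 1))).domRestrict
      (fun _ : Fin (m + 1) => e)) := by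
    refine ⟨fun i => he, fun i j hij => ?_⟩
    exact absurd (Subsingleton.elim i j) hij
  obtain ⟨b, hb⟩ := ho.exists_orthonormalBasis_extension_of_card_eq (by simp)
  refine ⟨b.repr, fun z => ?_⟩
  rw [b.repr_apply_apply, hb 0 (by simp)]

theorem slice_image_isometry {m : ℕ} (e : EuclideanSpace ℝ (Fin (m + 1)))
    (L : EuclideanSpace ℝ (Fin (m + 1)) ≃ₗᵢ[ℝ] EuclideanSpace ℝ (Fin (m + 1)))
    (hL : ∀ z, L z 0 = inner ℝ e z) (B : Set (EuclideanSpace ℝ (Fin (m + 1)))) (s : ℝ) :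
    μHE[m] (B ∩ {z | inner ℝ e z = s}) = μHE[m] ((L '' B) ∩ {z | z 0 = s}) := by
  rw [← L.isometry.euclideanHausdorffMeasure_image]
  congr 1
  ext z
  simp only [mem_image, mem_inter_iff, mem_ofPred_eq]
  constructor
  · rintro ⟨x, ⟨hx, hs⟩, rfl⟩
    exact ⟨⟨x, hx, rfl⟩, by rw [hL, hs]⟩
  · rintro ⟨⟨x, hx, rfl⟩, hs⟩
    exact ⟨x, ⟨hx, by rw [← hL, hs]⟩, rfl⟩

theorem measurable_slice {m : ℕ} (e : EuclideanSpace ℝ (Fin (m + 1))) (he : ‖e‖ = 1)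
    (B : Set (EuclideanSpace ℝ (Fin (m + 1)))) (hB : MeasurableSet B) :
    Measurable (fun s : ℝ => μHE[m] (B ∩ {z | inner ℝ e z = s})) := by
  obtain ⟨L, hL⟩ := exists_isometry_slice e he
  simp_rw [slice_image_isometry e L hL]
  exact slice_zero_measurable _ (L.toHomeomorph.toMeasurableEquiv.measurableSet_image.2 hB)

theorem lintegral_slice {m : ℕ} (e : EuclideanSpace ℝ (Fin (m + 1))) (he : ‖e‖ = 1)
    (B : Set (EuclideanSpace ℝ (Fin (m + 1)))) (hB : MeasurableSet B) :
    ∫⁻ s : ℝ, μHE[m] (B ∩ {z | inner ℝ e z = s}) = volume B := by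
  obtain ⟨L, hL⟩ := exists_isometry_slice e he
  simp_rw [slice_image_isometry e L hL]
  have hLB : MeasurableSet (L '' B) :=
    L.toHomeomorph.toMeasurableEquiv.measurableSet_image.2 hB
  rw [lintegral_slice_zero _ hLB]
  rw [← L.measurePreserving.measure_preimage_emb L.toHomeomorph.measurableEmbedding,
    preimage_image_eq _ L.injective]

/-! ### The coarea formula on the regular set. -/

/-- A `K`-Lipschitz map increases `μHE[k]` by a factor of at most `K ^ k`. -/
theorem LipschitzOnWith.euclideanHausdorffMeasure_image_le {X Y : Type*} [EMetricSpace X]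
    [MeasurableSpace X] [BorelSpace X] [EMetricSpace Y] [MeasurableSpace Y] [BorelSpace Y]
    {K : ℝ≥0} {f : X → Y} {s : Set X} (h : LipschitzOnWith K f s) (k : ℕ) :
    μHE[k] (f '' s) ≤ (K : ℝ≥0∞) ^ k * μHE[k] s := by
  simp_rw [Measure.euclideanHausdorffMeasure_def, Measure.smul_apply]
  have := h.hausdorffMeasure_image_le (d := k) (by positivity)
  rw [ENNReal.rpow_natCast] at this
  calc _ ≤ _ • ((K : ℝ≥0∞) ^ k * μH[k] s) := by gcongr
    _ = _ := by rw [mul_smul_comm]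

/-- The hypothesis makes the inverse of `f` a `K`-Lipschitz map on `f '' s`. -/
theorem euclideanHausdorffMeasure_le_image_of_dist_le {X Y : Type*} [MetricSpace X]
    [MeasurableSpace X] [BorelSpace X] [MetricSpace Y] [MeasurableSpace Y] [BorelSpace Y]
    {K : ℝ≥0} {f : X → Y} {s : Set X} (h : ∀ x ∈ s, ∀ y ∈ s, dist x y ≤ K * dist (f x) (f y))
    (k : ℕ) : μHE[k] s ≤ (K : ℝ≥0∞) ^ k * μHE[k] (f '' s) := by
  rcases s.eq_empty_or_nonempty with rfl | ⟨x₀, -⟩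
  · simp
  have : Nonempty X := ⟨x₀⟩
  have hinj : InjOn f s := fun x hx y hy hxy => by
    have := h x hx y hy
    rw [hxy, dist_self, mul_zero] at this
    exact dist_le_zero.1 this
  have hL : LipschitzOnWith K (Function.invFunOn f s) (f '' s) := by
    refine LipschitzOnWith.of_dist_le_mul ?_
    rintro _ ⟨x, hx, rfl⟩ _ ⟨y, hy, rfl⟩
    rw [hinj.leftInvOn_invFunOn hx, hinj.leftInvOn_invFunOn hy]
    exact h x hx y hy
  have := hL.euclideanHausdorffMeasure_image_le k
  rwa [hinj.invFunOn_image subset_rfl] at this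

/-- The measures of the slices `A ∩ {g = t}` are comparable, with ratio at most `C`, to a
measurable function whose integral is comparable to the integral of `|∇g|` over `A`. -/
def CoareaComparable {m : ℕ} (g : EuclideanSpace ℝ (Fin (m + 1)) → ℝ) (C : ℝ≥0∞)
    (A : Set (EuclideanSpace ℝ (Fin (m + 1)))) : Prop :=
  ∃ h : ℝ → ℝ≥0∞, Measurable h ∧ (∀ t, μHE[m] (A ∩ {x | g x = t}) ≤ C * h t) ∧
    (∀ t, h t ≤ C * μHE[m] (A ∩ {x | g x = t})) ∧
    ∫⁻ t, h t ≤ C * ∫⁻ x in A, ‖gradient g x‖ₑ ∧ ∫⁻ x in A, ‖gradient g x‖ₑ ≤ C * ∫⁻ t, h t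

/-- Both sides are countably additive over disjoint pieces, so the constant does not deteriorate.
The measurable proxy `h` is carried along because measurability of the slice measure itself is
obtained only in the limit of constants tending to 1. -/
theorem CoareaComparable.iUnion {m : ℕ} {g : EuclideanSpace ℝ (Fin (m + 1)) → ℝ} {C : ℝ≥0∞}
    {A : ℕ → Set (EuclideanSpace ℝ (Fin (m + 1)))} (hA : ∀ n, CoareaComparable g C (A n))
    (hm : ∀ n, MeasurableSet (A n)) (hd : Pairwise (Function.onFun Disjoint A))
    (hl : ∀ n t, MeasurableSet (A n ∩ {x | g x = t})) :
    CoareaComparable g C (⋃ n, A n) := by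
  choose h h1 h2 h3 h4 h5 using hA
  have key : ∀ t, μHE[m] ((⋃ n, A n) ∩ {x | g x = t}) = ∑' n, μHE[m] (A n ∩ {x | g x = t}) := by
    intro t
    rw [iUnion_inter, measure_iUnion _ (fun n => hl n t)]
    exact fun i j hij => (hd hij).mono inter_subset_left inter_subset_left
  refine ⟨fun t => ∑' n, h n t, Measurable.tsum h1, ?_, ?_, ?_, ?_⟩
  · intro t
    rw [key, ← ENNReal.tsum_mul_left]
    exact ENNReal.tsum_le_tsum fun n => h2 n t
  · intro t
    rw [key, ← ENNReal.tsum_mul_left]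
    exact ENNReal.tsum_le_tsum fun n => h3 n t
  · rw [lintegral_tsum fun n => (h1 n).aemeasurable, lintegral_iUnion hm hd,
      ← ENNReal.tsum_mul_left]
    exact ENNReal.tsum_le_tsum fun n => h4 n
  · rw [lintegral_tsum fun n => (h1 n).aemeasurable, lintegral_iUnion hm hd,
      ← ENNReal.tsum_mul_left]
    exact ENNReal.tsum_le_tsum fun n => h5 n

theorem lintegral_comp_div {h : ℝ → ℝ≥0∞} {a : ℝ} (ha : 0 < a) :
    ∫⁻ t, h (t / a) = ENNReal.ofReal a * ∫⁻ s, h s := by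
  have hmap := Real.map_volume_mul_right (a := a⁻¹) (inv_ne_zero ha.ne')
  have e : MeasurableEmbedding (fun t : ℝ => t * a⁻¹) :=
    (Homeomorph.mulRight₀ a⁻¹ (inv_ne_zero ha.ne')).measurableEmbedding
  simp_rw [div_eq_mul_inv]
  rw [← e.lintegral_map, hmap, lintegral_smul_measure, inv_inv, abs_of_pos ha, smul_eq_mul]

theorem exists_nhds_biLipschitz {E : Type*} [NormedAddCommGroup E] [NormedSpace ℝ E]
    {F : E → E} {x₀ : E} (hF : HasStrictFDerivAt F (ContinuousLinearMap.id ℝ E) x₀)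
    {K : ℝ≥0} (hK : 1 < K) :
    ∃ U ∈ 𝓝 x₀, LipschitzOnWith K F U ∧ ∀ x ∈ U, ∀ y ∈ U, dist x y ≤ K * dist (F x) (F y) := by
  have hK' : (1 : ℝ) < K := by exact_mod_cast hK
  have hc : 0 < 1 - (K : ℝ)⁻¹ := by
    have := inv_lt_one_of_one_lt₀ hK'
    linarith
  have h := hF.isLittleO.def hc
  rw [nhds_prod_eq] at h
  obtain ⟨U, hU, hU'⟩ := Filter.eventually_prod_self_iff
    (r := fun x y => ‖F x - F y - (ContinuousLinearMap.id ℝ E) (x - y)‖ ≤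
      (1 - (K : ℝ)⁻¹) * ‖x - y‖).1 h
  -- `F - id` has Lipschitz constant `1 - K⁻¹` near `x₀`, chosen for the lower bound; this
  -- inequality shows that it also serves the upper bound.
  have hle : 1 - (K : ℝ)⁻¹ ≤ K - 1 := by
    have hk : (K : ℝ) * (K : ℝ)⁻¹ = 1 := mul_inv_cancel₀ (by linarith)
    nlinarith [sq_nonneg ((K : ℝ) - 1), inv_pos.2 (show (0:ℝ) < K by linarith)]
  refine ⟨U, hU, LipschitzOnWith.of_dist_le_mul fun x hx y hy => ?_, fun x hx y hy => ?_⟩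
  · have h1 := hU' x hx y hy
    simp only [ContinuousLinearMap.coe_id', id_eq] at h1
    rw [dist_eq_norm, dist_eq_norm]
    have h2 : ‖F x - F y‖ ≤ ‖F x - F y - (x - y)‖ + ‖x - y‖ := by
      simpa using norm_add_le (F x - F y - (x - y)) (x - y)
    nlinarith [norm_nonneg (x - y)]
  · have h1 := hU' x hx y hy
    simp only [ContinuousLinearMap.coe_id', id_eq] at h1
    rw [dist_eq_norm, dist_eq_norm]
    have h2 : ‖x - y‖ ≤ ‖F x - F y‖ + ‖F x - F y - (x - y)‖ := by
      simpa using norm_sub_le (F x - F y) (F x - F y - (x - y))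
    have h3 : (K : ℝ)⁻¹ * ‖x - y‖ ≤ ‖F x - F y‖ := by linarith
    calc ‖x - y‖ = K * ((K : ℝ)⁻¹ * ‖x - y‖) := by
          rw [← mul_assoc, mul_inv_cancel₀ (by linarith), one_mul]
      _ ≤ _ := by gcongr

/-- The map `F` replaces the `e`-coordinate of `x` by `g x / a`, so it carries level sets of `g` to
hyperplane slices, and `DF(x₀) = id` because `e` is the direction of `∇g(x₀)`. Hence `F` is
bi-Lipschitz near `x₀` with constant `K`. The exponent `m + 2` is `m + 1` for volumes plus 1 for
replacing `|∇g|` by its value at `x₀`. -/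
theorem exists_nhds_coareaComparable {m : ℕ} {g : EuclideanSpace ℝ (Fin (m + 1)) → ℝ}
    {x₀ : EuclideanSpace ℝ (Fin (m + 1))} (hg : ContDiffAt ℝ 1 g x₀) (h0 : gradient g x₀ ≠ 0)
    {K : ℝ≥0} (hK : 1 < K) :
    ∃ U ∈ 𝓝 x₀, ∀ A ⊆ U, MeasurableSet A → CoareaComparable g ((K : ℝ≥0∞) ^ (m + 2)) A := by
  set a : ℝ := ‖gradient g x₀‖ with ha_def
  have ha : 0 < a := norm_pos_iff.2 h0
  set e : EuclideanSpace ℝ (Fin (m + 1)) := a⁻¹ • gradient g x₀ with he_def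
  have he : ‖e‖ = 1 := by
    rw [he_def, norm_smul, Real.norm_of_nonneg (inv_nonneg.2 ha.le), inv_mul_cancel₀ ha.ne']
  set F : EuclideanSpace ℝ (Fin (m + 1)) → EuclideanSpace ℝ (Fin (m + 1)) :=
    fun x => x + (a⁻¹ * g x - inner ℝ e x) • e with hF_def
  have heF : ∀ x, inner ℝ e (F x) = g x / a := by
    intro x
    simp only [hF_def, inner_add_right, inner_smul_right, real_inner_self_eq_norm_sq, he]
    ring
  have hgd : HasStrictFDerivAt g (fderiv ℝ g x₀) x₀ :=
    hg.hasStrictFDerivAt one_ne_zero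
  have hFd : HasStrictFDerivAt F (ContinuousLinearMap.id ℝ _) x₀ := by
    have h1 : HasStrictFDerivAt F (ContinuousLinearMap.id ℝ _ +
        (a⁻¹ • fderiv ℝ g x₀ - innerSL ℝ e).smulRight e) x₀ :=
      (hasStrictFDerivAt_id x₀).add
        (((hgd.const_mul a⁻¹).sub (innerSL ℝ e).hasStrictFDerivAt).smul_const e)
    have h2 : a⁻¹ • fderiv ℝ g x₀ - innerSL ℝ e = 0 := by
      ext y
      have : fderiv ℝ g x₀ y = inner ℝ (gradient g x₀) y := by simp [gradient]
      change a⁻¹ * fderiv ℝ g x₀ y - inner ℝ e y = 0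
      rw [this, he_def, real_inner_smul_left, sub_self]
    rw [h2] at h1
    simpa using h1
  obtain ⟨U₁, hU₁, hL, hA⟩ := exists_nhds_biLipschitz hFd hK
  have hcont : ContinuousAt (fun x => ‖gradient g x‖) x₀ := by
    have : ContinuousAt (fderiv ℝ g) x₀ := by
      have := (hg.fderiv_right (m := 0) (by norm_num)).continuousAt
      exact this
    have h2 : (fun x => ‖gradient g x‖) = fun x => ‖fderiv ℝ g x‖ := by
      ext x; simp [gradient]
    rw [h2]; exact this.norm
  have hK' : (1 : ℝ) < K := by exact_mod_cast hK
  have hU₂ : ∀ᶠ x in 𝓝 x₀, a ≤ K * ‖gradient g x‖ ∧ ‖gradient g x‖ ≤ K * a := by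
    have h1 : ∀ᶠ x in 𝓝 x₀, a / K < ‖gradient g x‖ :=
      hcont.eventually_const_lt (by rw [div_lt_iff₀ (by linarith)]; nlinarith)
    have h2 : ∀ᶠ x in 𝓝 x₀, ‖gradient g x‖ < K * a :=
      hcont.eventually_lt_const (by nlinarith)
    filter_upwards [h1, h2] with x h1 h2
    rw [div_lt_iff₀ (by linarith)] at h1
    exact ⟨by linarith, h2.le⟩
  refine ⟨U₁ ∩ {x | a ≤ K * ‖gradient g x‖ ∧ ‖gradient g x‖ ≤ K * a}, inter_mem hU₁ hU₂, ?_⟩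
  intro A hAU hAm
  have hAU₁ : A ⊆ U₁ := fun x hx => (hAU hx).1
  have hinj : InjOn F A := fun x hx y hy hxy => by
    have := hA x (hAU₁ hx) y (hAU₁ hy)
    rw [hxy, dist_self, mul_zero] at this
    exact dist_le_zero.1 this
  have hFA : MeasurableSet (F '' A) :=
    hAm.image_of_continuousOn_injOn (hL.mono hAU₁).continuousOn hinj
  have hslice : ∀ t, F '' (A ∩ {x | g x = t}) = F '' A ∩ {z | inner ℝ e z = t / a} := by
    intro t
    ext z
    constructor
    · rintro ⟨x, ⟨hx, rfl⟩, rfl⟩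
      exact ⟨⟨x, hx, rfl⟩, heF x⟩
    · rintro ⟨⟨x, hx, rfl⟩, hz⟩
      refine ⟨x, ⟨hx, ?_⟩, rfl⟩
      have : g x / a = t / a := (heF x).symm.trans hz
      field_simp at this
      exact this
  have hK1 : (1 : ℝ≥0∞) ≤ K := by exact_mod_cast hK.le
  have hvol : ∀ s : Set (EuclideanSpace ℝ (Fin (m + 1))), volume s = μHE[m + 1] s := by
    intro s; rw [EuclideanSpace.euclideanHausdorffMeasure_eq_volume]
  have hint : ∫⁻ t, μHE[m] (F '' A ∩ {z | inner ℝ e z = t / a})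
      = ENNReal.ofReal a * volume (F '' A) := by
    rw [lintegral_comp_div (h := fun s => μHE[m] (F '' A ∩ {z | inner ℝ e z = s})) ha,
      lintegral_slice e he _ hFA]
  refine ⟨fun t => μHE[m] (F '' A ∩ {z | inner ℝ e z = t / a}),
    (measurable_slice e he _ hFA).comp (measurable_id.div_const a), ?_, ?_, ?_, ?_⟩
  · intro t
    simp only [← hslice]
    refine (euclideanHausdorffMeasure_le_image_of_dist_le (K := K) (f := F)
      (fun x hx y hy => hA x (hAU₁ hx.1) y (hAU₁ hy.1)) m).trans ?_
    gcongr
    · omega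
  · intro t
    simp only [← hslice]
    refine ((hL.mono (inter_subset_left.trans hAU₁)).euclideanHausdorffMeasure_image_le m).trans ?_
    gcongr
    · omega
  · rw [hint]
    calc ENNReal.ofReal a * volume (F '' A)
        ≤ ENNReal.ofReal a * ((K : ℝ≥0∞) ^ (m + 1) * volume A) := by
          rw [hvol, hvol]
          gcongr
          exact (hL.mono hAU₁).euclideanHausdorffMeasure_image_le _
      _ = (K : ℝ≥0∞) ^ (m + 1) * ∫⁻ x in A, ENNReal.ofReal a := by
          rw [setLIntegral_const]; ring
      _ ≤ (K : ℝ≥0∞) ^ (m + 1) * ∫⁻ x in A, K * ‖gradient g x‖ₑ := by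
          refine mul_le_mul_right ?_ _
          refine setLIntegral_mono' hAm fun x hx => ?_
          rw [← ofReal_norm, ← ENNReal.ofReal_coe_nnreal, ← ENNReal.ofReal_mul (by positivity)]
          exact ENNReal.ofReal_le_ofReal (hAU hx).2.1
      _ = _ := by
          rw [lintegral_const_mul' _ _ ENNReal.coe_ne_top]; ring
  · rw [hint]
    calc ∫⁻ x in A, ‖gradient g x‖ₑ ≤ ∫⁻ x in A, K * ENNReal.ofReal a := by
          refine setLIntegral_mono' hAm fun x hx => ?_
          rw [← ofReal_norm, ← ENNReal.ofReal_coe_nnreal, ← ENNReal.ofReal_mul (by positivity)]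
          exact ENNReal.ofReal_le_ofReal (hAU hx).2.2
      _ = K * ENNReal.ofReal a * volume A := by rw [setLIntegral_const]
      _ ≤ K * ENNReal.ofReal a * ((K : ℝ≥0∞) ^ (m + 1) * volume (F '' A)) := by
          rw [hvol, hvol]
          gcongr
          exact euclideanHausdorffMeasure_le_image_of_dist_le (K := K) (f := F)
            (fun x hx y hy => hA x (hAU₁ hx) y (hAU₁ hy)) _
      _ = _ := by ring

/-- The Lindelöf property gives a countable cover by neighbourhoods where the local comparison
holds; it is then made disjoint. -/
theorem coareaComparable_of_subset {m : ℕ} {g : EuclideanSpace ℝ (Fin (m + 1)) → ℝ}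
    {R : Set (EuclideanSpace ℝ (Fin (m + 1)))} (hg : ∀ x ∈ R, ContDiffAt ℝ 1 g x)
    (h0 : ∀ x ∈ R, gradient g x ≠ 0) {K : ℝ≥0} (hK : 1 < K)
    {A : Set (EuclideanSpace ℝ (Fin (m + 1)))} (hA : MeasurableSet A) (hAR : A ⊆ R) :
    CoareaComparable g ((K : ℝ≥0∞) ^ (m + 2)) A := by
  have hl : ∀ B ⊆ A, MeasurableSet B → ∀ t, MeasurableSet (B ∩ {x | g x = t}) := by
    intro B hB hBm t
    have hc : ContinuousOn g B := fun x hx =>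
      (hg x (hAR (hB hx))).continuousAt.continuousWithinAt
    obtain ⟨u, hu, hu'⟩ := (continuousOn_iff_isClosed.1 hc) {t} isClosed_singleton
    have : B ∩ {x | g x = t} = u ∩ B := by
      rw [← hu', inter_comm]; rfl
    rw [this]
    exact hu.measurableSet.inter hBm
  choose! U hU hUA using fun x (hx : x ∈ R) =>
    exists_nhds_coareaComparable (hg x hx) (h0 x hx) hK
  obtain ⟨T, hTR, hTc, hT⟩ := TopologicalSpace.countable_cover_nhdsWithin
    (f := fun x => interior (U x)) (s := R)
    (fun x hx => mem_nhdsWithin_of_mem_nhds (interior_mem_nhds.2 (hU x hx)))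
  rcases T.eq_empty_or_nonempty with rfl | hTne
  · have : A = ∅ := by
      have := hAR.trans hT
      simpa using this
    subst this
    exact ⟨fun _ => 0, measurable_const, by simp, by simp, by simp, by simp⟩
  obtain ⟨u, rfl⟩ := hTc.exists_eq_range hTne
  set D : ℕ → Set (EuclideanSpace ℝ (Fin (m + 1))) :=
    disjointed fun n => interior (U (u n)) with hD
  have hDm : ∀ n, MeasurableSet (D n) := fun n =>
    MeasurableSet.disjointed (fun n => isOpen_interior.measurableSet) n
  have hun : A = ⋃ n, A ∩ D n := by
    rw [← inter_iUnion, iUnion_disjointed, eq_comm, inter_eq_left]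
    refine (hAR.trans hT).trans ?_
    simp
  rw [hun]
  refine CoareaComparable.iUnion (fun n => ?_) (fun n => hA.inter (hDm n)) ?_ (fun n t => ?_)
  · refine hUA (u n) (hTR (mem_range_self n)) _ ?_ (hA.inter (hDm n))
    exact inter_subset_right.trans ((disjointed_subset _ n).trans interior_subset)
  · exact fun i j hij => ((disjoint_disjointed _) hij).mono inter_subset_right inter_subset_right
  · exact hl _ inter_subset_left (hA.inter (hDm n)) t

theorem le_of_forall_one_lt_pow_mul_le {n : ℕ} {a b : ℝ≥0∞}
    (h : ∀ K : ℝ≥0, 1 < K → a ≤ (K : ℝ≥0∞) ^ n * b) : a ≤ b := by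
  have ht : Tendsto (fun K : ℝ≥0 => (K : ℝ≥0∞) ^ n * b) (𝓝[>] 1) (𝓝 (1 * b)) := by
    refine ENNReal.Tendsto.mul_const ?_ (Or.inl one_ne_zero)
    have : Continuous fun K : ℝ≥0 => (K : ℝ≥0∞) ^ n := by fun_prop
    simpa using (this.tendsto 1).mono_left nhdsWithin_le_nhds
  rw [one_mul] at ht
  refine ge_of_tendsto ht ?_
  filter_upwards [self_mem_nhdsWithin] with K hK using h K hK

/-- **Coarea formula** for sets, on the regular set of a `C¹` function. -/
theorem coarea_set {m : ℕ} {g : EuclideanSpace ℝ (Fin (m + 1)) → ℝ}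
    {A : Set (EuclideanSpace ℝ (Fin (m + 1)))} (hg : ∀ x ∈ A, ContDiffAt ℝ 1 g x)
    (h0 : ∀ x ∈ A, gradient g x ≠ 0) (hA : MeasurableSet A) :
    Measurable (fun t => μHE[m] (A ∩ {x | g x = t})) ∧
      ∫⁻ t, μHE[m] (A ∩ {x | g x = t}) = ∫⁻ x in A, ‖gradient g x‖ₑ := by
  have hcomp : ∀ K : ℝ≥0, 1 < K → CoareaComparable g ((K : ℝ≥0∞) ^ (m + 2)) A := fun K hK =>
    coareaComparable_of_subset hg h0 hK hA subset_rfl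
  choose! h h1 h2 h3 h4 h5 using hcomp
  -- The measurable functions `h (K n)` are squeezed to the slice measure as `K n` decreases to 1.
  have hmeas : Measurable (fun t => μHE[m] (A ∩ {x | g x = t})) := by
    obtain ⟨K, hKanti, hK1, hKlim⟩ := exists_seq_strictAnti_tendsto (1 : ℝ≥0)
    refine measurable_of_tendsto_metrizable (f := fun n => h (K n)) (fun n => h1 _ (hK1 n)) ?_
    rw [tendsto_pi_nhds]
    intro t
    have hpow : Tendsto (fun n => (K n : ℝ≥0∞) ^ (m + 2)) atTop (𝓝 1) := by
      have : Continuous fun K : ℝ≥0 => (K : ℝ≥0∞) ^ (m + 2) := by fun_prop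
      simpa [Function.comp_def] using (this.tendsto 1).comp hKlim
    have hup : Tendsto (fun n => (K n : ℝ≥0∞) ^ (m + 2) * μHE[m] (A ∩ {x | g x = t})) atTop
        (𝓝 (1 * μHE[m] (A ∩ {x | g x = t}))) :=
      ENNReal.Tendsto.mul_const hpow (Or.inl one_ne_zero)
    have hlo : Tendsto (fun n => ((K n : ℝ≥0∞) ^ (m + 2))⁻¹ * μHE[m] (A ∩ {x | g x = t})) atTop
        (𝓝 (1⁻¹ * μHE[m] (A ∩ {x | g x = t}))) :=
      ENNReal.Tendsto.mul_const (tendsto_inv_iff.2 hpow) (Or.inl (by simp))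
    rw [one_mul] at hup
    rw [inv_one, one_mul] at hlo
    refine tendsto_of_tendsto_of_tendsto_of_le_of_le hlo hup (fun n => ?_) (fun n => ?_)
    · have hne : (K n : ℝ≥0∞) ^ (m + 2) ≠ 0 := by
        have := (zero_lt_one.trans (hK1 n)).ne'
        positivity
      have hnt : (K n : ℝ≥0∞) ^ (m + 2) ≠ ∞ := ENNReal.pow_ne_top ENNReal.coe_ne_top
      calc _ ≤ ((K n : ℝ≥0∞) ^ (m + 2))⁻¹ * ((K n : ℝ≥0∞) ^ (m + 2) * h (K n) t) := by
            gcongr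
            exact h2 _ (hK1 n) t
        _ = h (K n) t := by rw [← mul_assoc, ENNReal.inv_mul_cancel hne hnt, one_mul]
    · exact h3 _ (hK1 n) t
  refine ⟨hmeas, le_antisymm ?_ ?_⟩
  -- One factor `K ^ (m + 2)` for passing to `h`, a second for the integral of `h`.
  · refine le_of_forall_one_lt_pow_mul_le (n := (m + 2) + (m + 2)) fun K hK => ?_
    calc _ ≤ ∫⁻ t, (K : ℝ≥0∞) ^ (m + 2) * h K t := lintegral_mono fun t => h2 K hK t
      _ = (K : ℝ≥0∞) ^ (m + 2) * ∫⁻ t, h K t := lintegral_const_mul _ (h1 K hK)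
      _ ≤ (K : ℝ≥0∞) ^ (m + 2) * ((K : ℝ≥0∞) ^ (m + 2) * ∫⁻ x in A, ‖gradient g x‖ₑ) := by
        gcongr
        exact h4 K hK
      _ = _ := by ring
  · refine le_of_forall_one_lt_pow_mul_le (n := (m + 2) + (m + 2)) fun K hK => ?_
    calc _ ≤ (K : ℝ≥0∞) ^ (m + 2) * ∫⁻ t, h K t := h5 K hK
      _ ≤ (K : ℝ≥0∞) ^ (m + 2) *
          ∫⁻ t, (K : ℝ≥0∞) ^ (m + 2) * μHE[m] (A ∩ {x | g x = t}) := by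
        gcongr with t
        exact h3 K hK t
      _ = _ := by rw [lintegral_const_mul _ hmeas]; ring

/-- **Coarea formula** for nonnegative functions, on the regular set of a `C¹` function. -/
theorem coarea_lintegral {m : ℕ} {g : EuclideanSpace ℝ (Fin (m + 1)) → ℝ}
    {R : Set (EuclideanSpace ℝ (Fin (m + 1)))} (hR : MeasurableSet R)
    (hg : ∀ x ∈ R, ContDiffAt ℝ 1 g x) (h0 : ∀ x ∈ R, gradient g x ≠ 0)
    {f : EuclideanSpace ℝ (Fin (m + 1)) → ℝ≥0∞} (hf : Measurable f) :
    Measurable (fun t => ∫⁻ x in R ∩ {x | g x = t}, f x ∂μHE[m]) ∧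
      ∫⁻ t, ∫⁻ x in R ∩ {x | g x = t}, f x ∂μHE[m] = ∫⁻ x in R, f x * ‖gradient g x‖ₑ := by
  set κ : ℝ → Measure (EuclideanSpace ℝ (Fin (m + 1))) :=
    fun t => μHE[m].restrict (R ∩ {x | g x = t}) with hκ
  have hset : ∀ B, MeasurableSet B → ∀ t, κ t B = μHE[m] ((R ∩ B) ∩ {x | g x = t}) := by
    intro B hB t
    rw [hκ, Measure.restrict_apply hB]
    congr 1
    ext x
    simp only [mem_inter_iff]
    tauto
  have hco : ∀ B, MeasurableSet B → _ := fun B (hB : MeasurableSet B) =>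
    coarea_set (A := R ∩ B) (fun x hx => hg x hx.1) (fun x hx => h0 x hx.1) (hR.inter hB)
  have hκm : Measurable κ := by
    refine Measure.measurable_of_measurable_coe _ fun B hB => ?_
    simp_rw [hset B hB]
    exact (hco B hB).1
  have hgm : Measurable fun x => ‖gradient g x‖ₑ := by
    have : Measurable (fderiv ℝ g) := measurable_fderiv ℝ g
    have h2 : (fun x => ‖gradient g x‖ₑ) = fun x => ‖fderiv ℝ g x‖ₑ := by
      ext x
      simp [gradient, ← ofReal_norm]
    rw [h2]
    exact this.enorm
  -- The set version says that averaging the level measures over `t` gives the measure with density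
  -- `|∇g|` on `R`; integrating `f` against both sides is the claim.
  have hbind : Measure.bind volume κ = (volume.restrict R).withDensity fun x => ‖gradient g x‖ₑ := by
    ext B hB
    rw [Measure.bind_apply hB hκm.aemeasurable, withDensity_apply _ hB,
      Measure.restrict_restrict hB, inter_comm, ← (hco B hB).2]
    simp_rw [hset B hB]
  refine ⟨(Measure.measurable_lintegral hf).comp hκm, ?_⟩
  have := Measure.lintegral_bind (m := volume) (μ := κ) hκm.aemeasurable (f := f) hf.aemeasurable
  rw [← this, hbind, lintegral_withDensity_eq_lintegral_mul _ hgm hf]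
  simp_rw [Pi.mul_apply, mul_comm]

/-! ### Critical points are negligible on almost every level. -/

theorem exists_grid_cover {d : ℕ} {R : ℝ} (hR : 0 < R) (n : ℕ) :
    ∃ t : (Fin d → Fin (n + 1)) → Set (EuclideanSpace ℝ (Fin d)),
      (Metric.ball 0 R ⊆ ⋃ i, t i) ∧
      ∀ i, ∀ x ∈ t i, ∀ y ∈ t i, dist x y ≤ √d * (2 * R) / (n + 1) := by
  set δ : ℝ := 2 * R / (n + 1) with hδ
  have hδ0 : 0 < δ := by positivity
  refine ⟨fun i => {x | ∀ k, (i k : ℝ) * δ ≤ x k + R ∧ x k + R ≤ ((i k : ℝ) + 1) * δ}, ?_, ?_⟩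
  · intro x hx
    rw [mem_ball_zero_iff] at hx
    have hk : ∀ k, |x k| < R := fun k => lt_of_le_of_lt (by simpa using PiLp.norm_apply_le x k) hx
    have hpos : ∀ k, 0 ≤ (x k + R) / δ := fun k => by
      have := (abs_lt.1 (hk k)).1
      have : 0 ≤ x k + R := by linarith
      positivity
    have hlt : ∀ k, ⌊(x k + R) / δ⌋₊ < n + 1 := fun k => by
      rw [Nat.floor_lt (hpos k), div_lt_iff₀ hδ0, hδ]
      have := (abs_lt.1 (hk k)).2
      push_cast
      field_simp
      linarith
    refine mem_iUnion.2 ⟨fun k => ⟨_, hlt k⟩, fun k => ⟨?_, ?_⟩⟩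
    · have := Nat.floor_le (hpos k)
      rwa [le_div_iff₀ hδ0] at this
    · have := (Nat.lt_floor_add_one ((x k + R) / δ)).le
      rwa [div_le_iff₀ hδ0] at this
  · intro i x hx y hy
    rw [EuclideanSpace.dist_eq]
    have hle : ∀ k, dist (x k) (y k) ^ 2 ≤ δ ^ 2 := fun k => by
      refine pow_le_pow_left₀ dist_nonneg ?_ 2
      rw [Real.dist_eq, abs_le]
      have h1 := hx k
      have h2 := hy k
      constructor <;> nlinarith
    calc √(∑ k, dist (x k) (y k) ^ 2) ≤ √(∑ _k : Fin d, δ ^ 2) :=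
          Real.sqrt_le_sqrt (Finset.sum_le_sum fun k _ => hle k)
      _ = √d * δ := by
          rw [Finset.sum_const, Finset.card_univ, Fintype.card_fin, nsmul_eq_mul,
            Real.sqrt_mul (by positivity), Real.sqrt_sq hδ0.le]
      _ = _ := by rw [hδ]; ring

/-- A Sard-type statement: if `g` varies at most quadratically on a bounded set `C`, then almost
every level set of `g` meets `C` in a set of zero codimension-one measure. -/
theorem ae_euclideanHausdorffMeasure_level_eq_zero {m : ℕ} (hm : m ≠ 0)
    {C : Set (EuclideanSpace ℝ (Fin (m + 1)))} (hC : Bornology.IsBounded C)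
    {g : EuclideanSpace ℝ (Fin (m + 1)) → ℝ} {L : ℝ} (hL : 0 ≤ L)
    (hg : ∀ x ∈ C, ∀ y ∈ C, |g x - g y| ≤ L * dist x y ^ 2) :
    ∀ᵐ t : ℝ, μHE[m] (C ∩ {x | g x = t}) = 0 := by
  obtain ⟨R, hR, hCR⟩ := hC.subset_ball_lt 0 0
  choose T hT hTd using fun n => exists_grid_cover (d := m + 1) hR n
  set c : ℝ := √((m + 1 : ℕ) : ℝ) * (2 * R) with hc
  have hc0 : 0 ≤ c := by positivity
  set ρ : ℕ → ℝ := fun n => c / (n + 1) with hρ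
  have hρ0 : ∀ n, 0 ≤ ρ n := fun n => by positivity
  -- A cell of diameter at most `ρ n` meets only levels in an interval of radius `L * ρ n ^ 2`
  -- around one value of `g`.
  set J : ∀ n, (Fin (m + 1) → Fin (n + 1)) → Set ℝ := fun n i =>
    {t | ∃ h : (C ∩ T n i).Nonempty, t ∈ Metric.closedBall (g h.some) (L * ρ n ^ 2)} with hJ
  have hJm : ∀ n i, MeasurableSet (J n i) := by
    intro n i
    by_cases h : (C ∩ T n i).Nonempty
    · simp only [hJ, h, exists_true_left]
      exact Metric.isClosed_closedBall.measurableSet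
    · simp [hJ, h]
  have hJv : ∀ n i, volume (J n i) ≤ ENNReal.ofReal (2 * (L * ρ n ^ 2)) := by
    intro n i
    by_cases h : (C ∩ T n i).Nonempty
    · simp only [hJ, h, exists_true_left]
      exact (Real.volume_closedBall _ _).le
    · simp [hJ, h]
  set h : ℕ → ℝ → ℝ≥0∞ := fun n t =>
    ∑ i, (J n i).indicator (fun _ => ENNReal.ofReal (ρ n ^ m)) t with hh
  have hhm : ∀ n, Measurable (h n) := fun n =>
    Finset.measurable_fun_sum _ fun i _ => measurable_const.indicator (hJm n i)
  -- `(n + 1) ^ (m + 1)` cells, each contributing `ρ ^ m` over an interval of length `2 L ρ ^ 2`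
  -- with `ρ = c / (n + 1)`: one power of `1 / (n + 1)` remains.
  have hhint : ∀ n : ℕ, ∫⁻ t, h n t ≤ ENNReal.ofReal (2 * L * c ^ (m + 2) * (1 / ((n : ℝ) + 1))) := by
    intro n
    simp only [hh]
    rw [lintegral_finsetSum _ fun i _ => measurable_const.indicator (hJm n i)]
    calc _ ≤ ∑ i : Fin (m + 1) → Fin (n + 1), ENNReal.ofReal (ρ n ^ m) *
            ENNReal.ofReal (2 * (L * ρ n ^ 2)) := by
          refine Finset.sum_le_sum fun i _ => ?_
          rw [lintegral_indicator (hJm n i), setLIntegral_const]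
          gcongr
          exact hJv n i
      _ = ENNReal.ofReal (((n : ℝ) + 1) ^ (m + 1) * (ρ n ^ m * (2 * (L * ρ n ^ 2)))) := by
          rw [Finset.sum_const, Finset.card_univ, Fintype.card_fun, Fintype.card_fin,
            Fintype.card_fin, nsmul_eq_mul, ENNReal.ofReal_mul (p := ((n : ℝ) + 1) ^ (m + 1)) (by positivity),
            ENNReal.ofReal_mul (pow_nonneg (hρ0 n) m), ← ENNReal.ofReal_natCast]
          push_cast
          rfl
      _ = _ := by
          congr 1
          simp only [hρ, div_pow]
          field_simp
          ring
  -- Fatou's lemma; the liminf of the covering sums bounds the Hausdorff measure of the level.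
  have hlim : ∫⁻ t, liminf (fun n => h n t) atTop = 0 := by
    refine le_antisymm ((lintegral_liminf_le hhm).trans ?_) zero_le
    have ht : Tendsto (fun n : ℕ => ENNReal.ofReal (2 * L * c ^ (m + 2) * (1 / ((n : ℝ) + 1))))
        atTop (𝓝 0) := by
      have := (tendsto_one_div_add_atTop_nhds_zero_nat (𝕜 := ℝ)).const_mul (2 * L * c ^ (m + 2))
      rw [mul_zero] at this
      simpa using ENNReal.tendsto_ofReal this
    rw [← ht.liminf_eq]
    exact liminf_le_liminf (Eventually.of_forall hhint)
  rw [lintegral_eq_zero_iff (Measurable.liminf hhm)] at hlim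
  filter_upwards [hlim] with t ht
  have hle : (μH[(m : ℕ)] : Measure _) (C ∩ {x | g x = t}) ≤ liminf (fun n => h n t) atTop := by
    have hdiam : ∀ n i, Metric.ediam (C ∩ {x | g x = t} ∩ T n i) ≤ ENNReal.ofReal (ρ n) := by
      intro n i
      refine Metric.ediam_le fun x hx y hy => ?_
      rw [edist_dist]
      exact ENNReal.ofReal_le_ofReal (hTd n i x hx.2 y hy.2)
    refine (Measure.hausdorffMeasure_le_liminf_sum (m : ℝ) (C ∩ {x | g x = t}) (l := atTop)
      (fun n => ENNReal.ofReal (ρ n)) ?_ (fun n i => C ∩ {x | g x = t} ∩ T n i)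
      (Eventually.of_forall hdiam) (Eventually.of_forall fun n => ?_)).trans ?_
    · have := (tendsto_one_div_add_atTop_nhds_zero_nat (𝕜 := ℝ)).const_mul c
      rw [mul_zero] at this
      simpa [hρ, div_eq_mul_inv] using ENNReal.tendsto_ofReal this
    · rw [← inter_iUnion]
      exact subset_inter subset_rfl (inter_subset_left.trans (hCR.trans (hT n)))
    · refine liminf_le_liminf (Eventually.of_forall fun n => ?_)
      refine Finset.sum_le_sum fun i _ => ?_
      rw [ENNReal.rpow_natCast]
      by_cases hne : (C ∩ {x | g x = t} ∩ T n i).Nonempty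
      · obtain ⟨x, ⟨hxC, hxt⟩, hxT⟩ := hne
        have hne' : (C ∩ T n i).Nonempty := ⟨x, hxC, hxT⟩
        have hmem : t ∈ J n i := by
          refine ⟨hne', ?_⟩
          rw [Metric.mem_closedBall, Real.dist_eq, ← (show g x = t from hxt)]
          refine (hg x hxC _ hne'.some_mem.1).trans ?_
          gcongr
          exact hTd n i x hxT _ hne'.some_mem.2
        rw [indicator_of_mem hmem, ENNReal.ofReal_pow (hρ0 n)]
        gcongr
        exact hdiam n i
      · rw [not_nonempty_iff_eq_empty.1 hne]
        -- A piece missing the level contributes `0 ^ m`, which vanishes only because `m ≠ 0`.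
        simp [hm]
  rw [Measure.euclideanHausdorffMeasure_def, Measure.smul_apply]
  have : liminf (fun n => h n t) atTop = 0 := ht
  rw [this, nonpos_iff_eq_zero] at hle
  rw [hle, smul_zero]

/-! ### A one-sided divergence theorem on convex sets. -/

/-- A gauge-type function of a bounded open convex set: it is Lipschitz, below `1` exactly on the
set, and where it is differentiable its derivative supports the set at a nearby boundary point. -/
theorem exists_lipschitz_gauge {E : Type*} [NormedAddCommGroup E] [NormedSpace ℝ E]
    {Ω : Set E} (ho : IsOpen Ω) (hb : Bornology.IsBounded Ω)
    (hc : Convex ℝ Ω) (hne : Ω.Nonempty) :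
    ∃ (p : E → ℝ) (D : ℝ≥0) (M : ℝ), 0 ≤ M ∧ LipschitzWith D p ∧ (∀ x, p x < 1 ↔ x ∈ Ω) ∧
      ∀ x ∈ Ω, 0 < p x → DifferentiableAt ℝ p x → ∃ y ∈ frontier Ω, dist x y ≤ M * (1 - p x) ∧
        ∀ z ∈ Ω, fderiv ℝ p x (z - y) ≤ 0 := by
  obtain ⟨x₀, hx₀⟩ := hne
  set H : E ≃ₜ E := Homeomorph.addRight x₀
  set Q : Set E := H ⁻¹' Ω with hQ
  have hQmem : ∀ x, x - x₀ ∈ Q ↔ x ∈ Ω := fun x => by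
    change x - x₀ + x₀ ∈ Ω ↔ _
    rw [sub_add_cancel]
  have hQo : IsOpen Q := ho.preimage H.continuous
  have hQ0 : Q ∈ 𝓝 (0 : E) := hQo.mem_nhds (by change 0 + x₀ ∈ Ω; rwa [zero_add])
  have hQc : Convex ℝ Q := by
    have := hc.translate_preimage_left x₀
    exact this
  obtain ⟨D, hD⟩ := hQc.lipschitz_gauge hQ0
  obtain ⟨M, hM, hΩM⟩ := hb.subset_closedBall_lt 0 x₀
  have habs : Absorbent ℝ Q := absorbent_nhds_zero hQ0
  refine ⟨fun x => gauge Q (x - x₀), D, M, hM.le, ?_, ?_, ?_⟩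
  · have := hD.comp (LipschitzWith.id.sub (LipschitzWith.const x₀))
    simpa [Function.comp_def] using! this
  · intro x
    rw [gauge_lt_one_iff_mem_interior hQc hQ0, hQo.interior_eq, hQmem]
  intro x hx hpos hdiff
  set s := gauge Q (x - x₀) with hs
  have hs1 : s < 1 := by
    rw [hs, gauge_lt_one_iff_mem_interior hQc hQ0, hQo.interior_eq, hQmem]
    exact hx
  -- Subadditivity of the gauge bounds every directional derivative by the gauge of the direction.
  have hsub : ∀ u, fderiv ℝ (fun x => gauge Q (x - x₀)) x u ≤ gauge Q u := by
    intro u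
    have h1 := (hdiff.hasFDerivAt.hasLineDerivAt u).hasDerivWithinAt (s := Ioi 0)
    rw [hasDerivWithinAt_iff_tendsto_slope' self_notMem_Ioi] at h1
    refine le_of_tendsto h1 ?_
    filter_upwards [self_mem_nhdsWithin] with r hr
    have hr : 0 < r := hr
    rw [slope_def_field, div_le_iff₀ (by linarith)]
    simp only [zero_smul, add_zero, sub_zero]
    have h2 := gauge_add_le hQc habs (x - x₀) (r • u)
    rw [gauge_smul_of_nonneg hr.le, smul_eq_mul] at h2
    rw [show x + r • u - x₀ = x - x₀ + r • u by abel]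
    linarith
  -- Positive homogeneity gives the radial derivative.
  have hrad : s ≤ fderiv ℝ (fun x => gauge Q (x - x₀)) x (x - x₀) := by
    have h1 := (hdiff.hasFDerivAt.hasLineDerivAt (x - x₀)).hasDerivWithinAt (s := Ioi 0)
    rw [hasDerivWithinAt_iff_tendsto_slope' self_notMem_Ioi] at h1
    refine ge_of_tendsto h1 ?_
    filter_upwards [self_mem_nhdsWithin] with r hr
    have hr : 0 < r := hr
    rw [slope_def_field, le_div_iff₀ (by linarith)]
    simp only [zero_smul, add_zero, sub_zero]
    rw [show x + r • (x - x₀) - x₀ = (1 + r) • (x - x₀) by rw [add_smul, one_smul]; abel,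
      gauge_smul_of_nonneg (by linarith), smul_eq_mul]
    simp only [← hs]
    linarith
  -- The radial projection of `x` to the boundary.
  set y := x₀ + s⁻¹ • (x - x₀) with hy
  have hyQ : gauge Q (y - x₀) = 1 := by
    rw [hy, add_sub_cancel_left, gauge_smul_of_nonneg (inv_nonneg.2 hpos.le), smul_eq_mul, ← hs,
      inv_mul_cancel₀ hpos.ne']
  have hyf : y ∈ frontier Ω := by
    rw [gauge_eq_one_iff_mem_frontier hQc hQ0, hQ, ← H.preimage_frontier] at hyQ
    have : y - x₀ + x₀ ∈ frontier Ω := hyQ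
    rwa [sub_add_cancel] at this
  have hyM : ‖y - x₀‖ ≤ M := by
    have := closure_minimal hΩM Metric.isClosed_closedBall (frontier_subset_closure hyf)
    rwa [Metric.mem_closedBall, dist_eq_norm] at this
  refine ⟨y, hyf, ?_, fun z hz => ?_⟩
  · have hxy : x - y = -((1 - s) • (y - x₀)) := by
      have : x - x₀ = s • (y - x₀) := by
        rw [hy, add_sub_cancel_left, smul_smul, mul_inv_cancel₀ hpos.ne', one_smul]
      rw [sub_smul, one_smul, ← this]
      abel
    rw [dist_eq_norm, hxy, norm_neg, norm_smul, Real.norm_of_nonneg (by linarith), mul_comm]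
    gcongr
  · have h1 := hsub (z - x₀)
    have h2 : gauge Q (z - x₀) < 1 := by
      rw [gauge_lt_one_iff_mem_interior hQc hQ0, hQo.interior_eq, hQmem]
      exact hz
    have h3 : 1 ≤ fderiv ℝ (fun x => gauge Q (x - x₀)) x (y - x₀) := by
      rw [hy, add_sub_cancel_left, map_smul, smul_eq_mul]
      calc (1 : ℝ) = s⁻¹ * s := (inv_mul_cancel₀ hpos.ne').symm
        _ ≤ _ := by gcongr
    rw [show z - y = (z - x₀) - (y - x₀) by abel, map_sub]
    linarith

theorem lineDeriv_apply_eq_partialD {d : ℕ} {X : EuclideanSpace ℝ (Fin d) → EuclideanSpace ℝ (Fin d)}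
    {Y : EuclideanSpace ℝ (Fin d) → ℝ} {Ω : Set (EuclideanSpace ℝ (Fin d))} (ho : IsOpen Ω)
    {i : Fin d} (hX : DifferentiableOn ℝ X Ω) (hY : EqOn (fun x => X x i) Y Ω) (j : Fin d)
    {x : EuclideanSpace ℝ (Fin d)} (hx : x ∈ Ω) :
    lineDeriv ℝ Y x (EuclideanSpace.single j 1) = partialD X i j x := by
  have he : Y =ᶠ[𝓝 x] fun y => X y i := by
    filter_upwards [ho.mem_nhds hx] with y hy using (hY hy).symm
  have hd : DifferentiableAt ℝ (fun y => X y i) x :=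
    differentiableAt_euclidean.1 (hX.differentiableAt (ho.mem_nhds hx)) i
  rw [(hd.congr_of_eventuallyEq he).lineDeriv_eq_fderiv, he.fderiv_eq]
  rfl

theorem integrable_lineDeriv_mul {E : Type*} [NormedAddCommGroup E] [NormedSpace ℝ E]
    [FiniteDimensional ℝ E] [MeasurableSpace E] [BorelSpace E] {μ : Measure E}
    [IsLocallyFiniteMeasure μ] {f h : E → ℝ} {C D : ℝ≥0} (hf : LipschitzWith C f)
    (hh : LipschitzWith D h) (hs : HasCompactSupport h) (v : E) :
    Integrable (fun x => lineDeriv ℝ f x v * h x) μ ∧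
      Integrable (fun x => lineDeriv ℝ h x v * f x) μ := by
  refine ⟨?_, ?_⟩
  · exact (hh.continuous.integrable_of_hasCompactSupport hs).bdd_mul
      (aestronglyMeasurable_lineDeriv hf.continuous μ)
      (Eventually.of_forall fun x => norm_lineDeriv_le_of_lipschitz ℝ hf)
  · have hsupp : Function.support (fun x => lineDeriv ℝ h x v * f x) ⊆ tsupport h := by
      intro x hx
      by_contra hxt
      refine hx ?_
      have h0 : h =ᶠ[𝓝 x] fun _ => (0 : ℝ) := notMem_tsupport_iff_eventuallyEq.1 hxt
      have hd : DifferentiableAt ℝ h x := (differentiableAt_const _).congr_of_eventuallyEq h0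
      simp [hd.lineDeriv_eq_fderiv, h0.fderiv_eq]
    rw [← integrableOn_iff_integrable_of_support_subset hsupp]
    exact Integrable.bdd_mul (hf.continuous.continuousOn.integrableOn_compact hs)
      (aestronglyMeasurable_lineDeriv hh.continuous _)
      (Eventually.of_forall fun x => norm_lineDeriv_le_of_lipschitz ℝ hh)

theorem sum_fderiv_neg_single_mul {d : ℕ} (L : EuclideanSpace ℝ (Fin d) →L[ℝ] ℝ)
    (u : EuclideanSpace ℝ (Fin d)) :
    ∑ i, L (-(EuclideanSpace.single i 1)) * u i = -L u := by
  have hu : u = ∑ i, u i • EuclideanSpace.single i (1 : ℝ) := by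
    ext j
    simp [Pi.single_apply]
  conv_rhs => rw [hu]
  simp [map_sum, mul_comm]

/-- Integration by parts moves the derivative to the cutoff, whose gradient is `-∇p / δ` in the
layer `1 - δ < p < 1` and zero elsewhere, almost everywhere. At a point `x` of the layer, `Dp(x)`
supports `Ω` at some boundary point `y` within `M δ`, where `Dp(x)(X y) ≤ 0`; hence `Dp(x)(X x) ≤ D
C M δ`, and `δ` cancels. -/
theorem setIntegral_divergence_mul_cutoff_le {d : ℕ} {Ω : Set (EuclideanSpace ℝ (Fin d))}
    (ho : IsOpen Ω) (hb : Bornology.IsBounded Ω)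
    {X : EuclideanSpace ℝ (Fin d) → EuclideanSpace ℝ (Fin d)} {C : ℝ≥0}
    (hX : LipschitzOnWith C X (closure Ω)) (hXd : DifferentiableOn ℝ X Ω)
    (hn : ∀ y ∈ frontier Ω, ∀ ℓ : EuclideanSpace ℝ (Fin d) →L[ℝ] ℝ,
      (∀ z ∈ Ω, ℓ (z - y) ≤ 0) → ℓ (X y) ≤ 0)
    {p : EuclideanSpace ℝ (Fin d) → ℝ} {D : ℝ≥0} {M : ℝ} (hM : 0 ≤ M) (hp : LipschitzWith D p)
    (hp1 : ∀ x, p x < 1 ↔ x ∈ Ω)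
    (hp2 : ∀ x ∈ Ω, 0 < p x → DifferentiableAt ℝ p x → ∃ y ∈ frontier Ω,
      dist x y ≤ M * (1 - p x) ∧ ∀ z ∈ Ω, fderiv ℝ p x (z - y) ≤ 0)
    {δ : ℝ} (hδ : 0 < δ) (hδ1 : δ ≤ 1) :
    ∫ x in Ω, divergence X x * max 0 (min 1 ((1 - p x) / δ)) ≤
      D * C * M * (volume (Ω ∩ {x | 1 - δ < p x})).toReal := by
  set η : EuclideanSpace ℝ (Fin d) → ℝ := fun x => max 0 (min 1 ((1 - p x) / δ)) with hη
  have hη0 : ∀ x, x ∉ Ω → η x = 0 := by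
    intro x hx
    have : 1 ≤ p x := not_lt.1 (fun h => hx ((hp1 x).1 h))
    refine max_eq_left (min_le_iff.2 (Or.inr ?_))
    exact div_nonpos_of_nonpos_of_nonneg (by linarith) hδ.le
  obtain ⟨Dη, hηL⟩ : ∃ Dη, LipschitzWith Dη η := by
    have h1 : LipschitzWith (Real.toNNReal (D / δ)) fun x => (1 - p x) / δ := by
      refine LipschitzWith.of_dist_le' fun x y => ?_
      have := hp.dist_le_mul x y
      rw [Real.dist_eq] at this ⊢
      rw [← sub_div, abs_div, abs_of_pos hδ, div_mul_eq_mul_div]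
      gcongr
      rw [show 1 - p x - (1 - p y) = -(p x - p y) by ring, abs_neg]
      exact this
    exact ⟨_, (h1.const_min 1).const_max 0⟩
  have hηs : HasCompactSupport η :=
    HasCompactSupport.intro hb.isCompact_closure fun x hx =>
      hη0 x fun h => hx (subset_closure h)
  -- Integration by parts is applied to functions Lipschitz on the whole space; the values outside
  -- `Ω` are irrelevant since the cutoff vanishes there.
  have hext : ∀ i, ∃ Y : EuclideanSpace ℝ (Fin d) → ℝ, LipschitzWith C Y ∧
      EqOn (fun x => X x i) Y (closure Ω) := by
    intro i
    refine LipschitzOnWith.extend_real ?_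
    refine LipschitzOnWith.of_dist_le_mul fun x hx y hy => ?_
    refine le_trans ?_ (hX.dist_le_mul x hx y hy)
    simpa [dist_eq_norm] using PiLp.norm_apply_le (X x - X y) i
  choose Y hY hXY using hext
  have hΩm : MeasurableSet Ω := ho.measurableSet
  have e1 : ∫ x in Ω, divergence X x * η x =
      ∫ x, ∑ i, lineDeriv ℝ (Y i) x (EuclideanSpace.single i 1) * η x := by
    rw [← integral_indicator hΩm]
    refine integral_congr_ae (Eventually.of_forall fun x => ?_)
    by_cases hx : x ∈ Ω
    · simp only [indicator_of_mem hx, divergence, Finset.sum_mul]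
      refine Finset.sum_congr rfl fun i _ => ?_
      rw [lineDeriv_apply_eq_partialD ho hXd ((hXY i).mono subset_closure) i hx]
    · simp [indicator_of_notMem hx, hη0 x hx]
  have e2 : ∫ x, ∑ i, lineDeriv ℝ (Y i) x (EuclideanSpace.single i 1) * η x =
      ∫ x, ∑ i, lineDeriv ℝ η x (-(EuclideanSpace.single i 1)) * Y i x := by
    rw [integral_finsetSum _ fun i _ => (integrable_lineDeriv_mul (hY i) hηL hηs _).1,
      integral_finsetSum _ fun i _ => (integrable_lineDeriv_mul (hY i) hηL hηs _).2]
    exact Finset.sum_congr rfl fun i _ => (hY i).integral_lineDeriv_mul_eq hηL hηs _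
  have hlm : MeasurableSet (Ω ∩ {x | 1 - δ < p x}) :=
    hΩm.inter (isOpen_lt continuous_const hp.continuous).measurableSet
  have hlf : volume (Ω ∩ {x | 1 - δ < p x}) ≠ ∞ :=
    ((measure_mono inter_subset_left).trans_lt hb.measure_lt_top).ne
  have hae : ∀ᵐ x, ∑ i, lineDeriv ℝ η x (-(EuclideanSpace.single i 1)) * Y i x ≤
      (Ω ∩ {x | 1 - δ < p x}).indicator (fun _ => D * C * M) x := by
    filter_upwards [hηL.ae_differentiableAt] with x hx
    simp_rw [hx.lineDeriv_eq_fderiv]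
    by_cases hxl : x ∈ Ω ∩ {x | 1 - δ < p x}
    · obtain ⟨hxΩ, hxp⟩ := id hxl
      have hxp' : p x < 1 := (hp1 x).2 hxΩ
      have hxp : 1 - δ < p x := hxp
      rw [indicator_of_mem hxl]
      have hev : η =ᶠ[𝓝 x] fun x => (1 - p x) / δ := by
        filter_upwards [hp.continuous.continuousAt.eventually_lt_const hxp',
          hp.continuous.continuousAt.eventually_const_lt hxp] with z hz1 hz2
        simp only [hη]
        rw [min_eq_right, max_eq_right]
        · exact div_nonneg (by linarith) hδ.le
        · rw [div_le_one hδ]; linarith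
      have hpd : DifferentiableAt ℝ p x := by
        have h1 : p =ᶠ[𝓝 x] fun x => 1 - δ * η x := by
          filter_upwards [hev] with z hz
          rw [hz]
          field_simp
          ring
        exact ((hx.const_mul δ).const_sub 1).congr_of_eventuallyEq h1
      have hfd : fderiv ℝ η x = -(δ⁻¹ • fderiv ℝ p x) := by
        rw [hev.fderiv_eq]
        have := (hpd.hasFDerivAt.const_sub 1).mul_const δ⁻¹
        simp_rw [div_eq_mul_inv]
        rw [this.fderiv, smul_neg]
      obtain ⟨y, hy, hxy, hz⟩ := hp2 x hxΩ (by linarith) hpd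
      have hsum : ∑ i, fderiv ℝ η x (-(EuclideanSpace.single i 1)) * Y i x =
          δ⁻¹ * fderiv ℝ p x (X x) := by
        have : ∀ i, Y i x = X x i := fun i => (hXY i (subset_closure hxΩ)).symm
        simp_rw [this]
        rw [sum_fderiv_neg_single_mul, hfd]
        simp
      rw [hsum]
      have hle : fderiv ℝ p x (X x) ≤ D * (C * (M * δ)) := by
        have h1 := hn y hy _ hz
        have h2 : fderiv ℝ p x (X x) = fderiv ℝ p x (X y) + fderiv ℝ p x (X x - X y) := by
          rw [map_sub]; ring
        have h3 : fderiv ℝ p x (X x - X y) ≤ D * ‖X x - X y‖ :=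
          (le_abs_self _).trans (((fderiv ℝ p x).le_opNorm _).trans
            (by gcongr; exact norm_fderiv_le_of_lipschitz ℝ hp))
        have h4 : ‖X x - X y‖ ≤ C * (M * δ) := by
          rw [← dist_eq_norm]
          refine (hX.dist_le_mul x (subset_closure hxΩ) y (frontier_subset_closure hy)).trans ?_
          gcongr
          refine hxy.trans ?_
          gcongr
          linarith
        have h5 : (D : ℝ) * ‖X x - X y‖ ≤ D * (C * (M * δ)) := by gcongr
        linarith
      calc δ⁻¹ * fderiv ℝ p x (X x) ≤ δ⁻¹ * (D * (C * (M * δ))) := by gcongr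
        _ = D * C * M := by field_simp
    · rw [indicator_of_notMem hxl]
      -- Off the layer the cutoff attains its maximum 1 or its minimum 0.
      have hzero : fderiv ℝ η x = 0 := by
        by_cases hxΩ : x ∈ Ω
        · have hxp : p x ≤ 1 - δ := not_lt.1 fun h => hxl ⟨hxΩ, h⟩
          have h1 : η x = 1 := by
            simp only [hη]
            rw [min_eq_left, max_eq_right zero_le_one]
            rw [le_div_iff₀ hδ]; linarith
          refine IsLocalMax.fderiv_eq_zero (Eventually.of_forall fun z => ?_)
          rw [h1]
          exact max_le zero_le_one (min_le_left _ _)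
        · refine IsLocalMin.fderiv_eq_zero (Eventually.of_forall fun z => ?_)
          rw [hη0 x hxΩ]
          exact le_max_left _ _
      simp [hzero]
  rw [e1, e2]
  calc _ ≤ ∫ x, (Ω ∩ {x | 1 - δ < p x}).indicator (fun _ => (D * C * M : ℝ)) x := by
        refine integral_mono_ae (integrable_finsetSum _ fun i _ =>
          (integrable_lineDeriv_mul (hY i) hηL hηs _).2) ?_ hae
        exact (integrable_indicator_iff hlm).2 (integrableOn_const hlf)
    _ = _ := by
        rw [integral_indicator hlm, setIntegral_const, smul_eq_mul, mul_comm]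
        rfl

/-- If a Lipschitz field does not point out of a bounded convex open set, the integral of its
divergence over the set is nonpositive. -/
theorem setIntegral_divergence_nonpos {d : ℕ} {Ω : Set (EuclideanSpace ℝ (Fin d))}
    (ho : IsOpen Ω) (hb : Bornology.IsBounded Ω) (hc : Convex ℝ Ω)
    {X : EuclideanSpace ℝ (Fin d) → EuclideanSpace ℝ (Fin d)} {C : ℝ≥0}
    (hX : LipschitzOnWith C X (closure Ω)) (hXd : DifferentiableOn ℝ X Ω)
    (hi : IntegrableOn (divergence X) Ω)
    (hn : ∀ y ∈ frontier Ω, ∀ ℓ : EuclideanSpace ℝ (Fin d) →L[ℝ] ℝ,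
      (∀ z ∈ Ω, ℓ (z - y) ≤ 0) → ℓ (X y) ≤ 0) :
    ∫ x in Ω, divergence X x ≤ 0 := by
  rcases Ω.eq_empty_or_nonempty with rfl | hne
  · simp
  obtain ⟨p, D, M, hM, hp, hp1, hp2⟩ := exists_lipschitz_gauge ho hb hc hne
  have hδ0 : ∀ n : ℕ, (0 : ℝ) < 1 / ((n : ℝ) + 1) := fun n => by positivity
  have hδ1 : ∀ n : ℕ, 1 / ((n : ℝ) + 1) ≤ 1 := fun n => by
    rw [div_le_one (by positivity)]
    have : (0 : ℝ) ≤ n := by positivity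
    linarith
  have hlimδ := tendsto_one_div_add_atTop_nhds_zero_nat (𝕜 := ℝ)
  have hev : ∀ x ∈ Ω, ∀ᶠ n : ℕ in atTop, 1 / ((n : ℝ) + 1) < 1 - p x := fun x hx =>
    hlimδ.eventually_lt_const (by linarith [(hp1 x).2 hx])
  have hle := fun n : ℕ => setIntegral_divergence_mul_cutoff_le ho hb hX hXd hn hM hp hp1 hp2
    (hδ0 n) (hδ1 n)
  have hl : Tendsto (fun n : ℕ => ∫ x in Ω, divergence X x *
      max 0 (min 1 ((1 - p x) / (1 / ((n : ℝ) + 1))))) atTop (𝓝 (∫ x in Ω, divergence X x)) := by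
    refine tendsto_integral_of_dominated_convergence (fun x => ‖divergence X x‖) ?_ hi.norm ?_ ?_
    · intro n
      refine hi.aestronglyMeasurable.mul (Continuous.aestronglyMeasurable ?_)
      have := hp.continuous
      fun_prop
    · intro n
      refine Eventually.of_forall fun x => ?_
      rw [norm_mul]
      refine mul_le_of_le_one_right (norm_nonneg _) ?_
      rw [Real.norm_of_nonneg (le_max_left _ _)]
      exact max_le zero_le_one (min_le_left _ _)
    · refine (ae_restrict_iff' ho.measurableSet).2 (Eventually.of_forall fun x hx => ?_)
      refine tendsto_const_nhds.congr' ?_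
      filter_upwards [hev x hx] with n hn
      rw [min_eq_left, max_eq_right zero_le_one, mul_one]
      rw [le_div_iff₀ (hδ0 n)]
      linarith
  -- The layers decrease to the empty set, since `p < 1` on `Ω`.
  have hr : Tendsto (fun n : ℕ => D * C * M *
      (volume (Ω ∩ {x | 1 - 1 / ((n : ℝ) + 1) < p x})).toReal) atTop (𝓝 (D * C * M * 0)) := by
    refine Tendsto.const_mul _ ?_
    have h0 : Tendsto (fun n : ℕ => volume (Ω ∩ {x | 1 - 1 / ((n : ℝ) + 1) < p x})) atTop
        (𝓝 (volume (⋂ n : ℕ, Ω ∩ {x | 1 - 1 / ((n : ℝ) + 1) < p x}))) := by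
      refine tendsto_measure_iInter_atTop (fun n => ?_) ?_ ⟨0, ?_⟩
      · exact (ho.measurableSet.inter
          (isOpen_lt continuous_const hp.continuous).measurableSet).nullMeasurableSet
      · intro n k hnk x hx
        have hxk : 1 - 1 / ((k : ℝ) + 1) < p x := hx.2
        refine ⟨hx.1, ?_⟩
        change 1 - 1 / ((n : ℝ) + 1) < p x
        have : 1 / ((k : ℝ) + 1) ≤ 1 / ((n : ℝ) + 1) := by gcongr
        linarith
      · exact ((measure_mono inter_subset_left).trans_lt hb.measure_lt_top).ne
    have he : (⋂ n : ℕ, Ω ∩ {x | 1 - 1 / ((n : ℝ) + 1) < p x}) = ∅ := by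
      refine eq_empty_of_forall_notMem fun x hx => ?_
      rw [mem_iInter] at hx
      obtain ⟨n, hn⟩ := (hev x (hx 0).1).exists
      have : 1 - 1 / ((n : ℝ) + 1) < p x := (hx n).2
      linarith
    rw [he, measure_empty] at h0
    exact (ENNReal.tendsto_toReal ENNReal.zero_ne_top).comp h0
  rw [mul_zero] at hr
  exact le_of_tendsto_of_tendsto' hl hr hle

/-! ### Boundary geometry: normals, convexity and tangential fields. -/

theorem IsPreconnected.exists_mem_frontier {X : Type*} [TopologicalSpace X] {s t : Set X}
    (hs : IsPreconnected s) (ht : IsOpen t) {a b : X} (ha : a ∈ s) (hat : a ∈ t) (hb : b ∈ s)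
    (hbt : b ∉ t) : ∃ q ∈ s, q ∈ frontier t := by
  by_contra! h
  have hcl : ∀ q ∈ s, q ∉ t → q ∉ closure t := fun q hq hqt hqc =>
    h q hq (by rw [ht.frontier_eq]; exact ⟨hqc, hqt⟩)
  obtain ⟨q, -, hq1, hq2⟩ := hs t (closure t)ᶜ ht isClosed_closure.isOpen_compl
    (fun q hq => by
      by_cases hqt : q ∈ t
      · exact Or.inl hqt
      · exact Or.inr (hcl q hq hqt)) ⟨a, ha, hat⟩ ⟨b, hb, hcl b hb hbt⟩
  exact hq2 (subset_closure hq1)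

theorem HasFDerivAt.eventually_lt_add_smul {E : Type*} [NormedAddCommGroup E] [NormedSpace ℝ E]
    {ρ : E → ℝ} {N : E →L[ℝ] ℝ} {y : E} (h : HasFDerivAt ρ N y) {u : E} (hu : N u < 0) :
    ∀ᶠ s : ℝ in 𝓝[>] 0, ρ (y + s • u) < ρ y := by
  have h1 := (h.hasLineDerivAt u).hasDerivWithinAt (s := Ioi 0)
  rw [hasDerivWithinAt_iff_tendsto_slope' self_notMem_Ioi] at h1
  filter_upwards [h1.eventually_lt_const hu, self_mem_nhdsWithin] with s hs hs0
  have hs0 : 0 < s := hs0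
  rw [slope_def_field, div_lt_iff₀ (by linarith)] at hs
  simp only [zero_smul, add_zero, zero_mul] at hs
  linarith

section DefiningFunction

variable {d : ℕ} {Ω U : Set (EuclideanSpace ℝ (Fin d))} {ρ : EuclideanSpace ℝ (Fin d) → ℝ}
  {p q y : EuclideanSpace ℝ (Fin d)}

theorem IsC2DefiningFunction.contDiffAt (h : IsC2DefiningFunction Ω p U ρ) (hq : q ∈ U) :
    ContDiffAt ℝ 2 ρ q :=
  h.contDiffOn.contDiffAt (h.isOpen.mem_nhds hq)

theorem IsC2DefiningFunction.hasFDerivAt (h : IsC2DefiningFunction Ω p U ρ) (hq : q ∈ U) :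
    HasFDerivAt ρ (fderiv ℝ ρ q) q :=
  ((h.contDiffAt hq).differentiableAt (by norm_num)).hasFDerivAt

theorem IsC2DefiningFunction.neg_iff (h : IsC2DefiningFunction Ω p U ρ) (hq : q ∈ U) :
    ρ q < 0 ↔ q ∈ Ω := by
  have := Set.ext_iff.1 h.inter_eq q
  simp only [mem_inter_iff, mem_ofPred_eq] at this
  tauto

theorem IsC2DefiningFunction.eq_zero (h : IsC2DefiningFunction Ω p U ρ) (ho : IsOpen Ω)
    (hq : q ∈ U) (hqf : q ∈ frontier Ω) : ρ q = 0 := by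
  rw [ho.frontier_eq] at hqf
  refine le_antisymm ?_ (not_lt.1 fun hlt => hqf.2 ((h.neg_iff hq).1 hlt))
  by_contra! hpos
  have hev : ∀ᶠ z in 𝓝 q, 0 < ρ z := (h.contDiffAt hq).continuousAt.eventually_const_lt hpos
  obtain ⟨z, hzΩ, hz, hzU⟩ := ((mem_closure_iff_frequently.1 hqf.1).and_eventually
    (hev.and (h.isOpen.mem_nhds hq))).exists
  have := (h.neg_iff hzU).2 hzΩ
  linarith

/-- A positive derivative towards `z ∈ Ω` would make `ρ` positive just after `q`, yet by convexity
the open segment from `q` to `z` lies in `Ω`, where `ρ < 0`. -/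
theorem IsC2DefiningFunction.fderiv_sub_nonpos (h : IsC2DefiningFunction Ω p U ρ) (ho : IsOpen Ω)
    (hc : Convex ℝ Ω) (hq : q ∈ U) (hqf : q ∈ frontier Ω) {z : EuclideanSpace ℝ (Fin d)}
    (hz : z ∈ closure Ω) : fderiv ℝ ρ q (z - q) ≤ 0 := by
  have hcl : IsClosed {z | fderiv ℝ ρ q (z - q) ≤ 0} :=
    isClosed_le (by fun_prop) continuous_const
  refine closure_minimal (fun z hz => ?_) hcl hz
  change fderiv ℝ ρ q (z - q) ≤ 0
  by_contra! hpos
  have h1 := (h.hasFDerivAt hq).neg.eventually_lt_add_smul (u := z - q) (by simpa using hpos)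
  have h2 : ∀ᶠ s : ℝ in 𝓝[>] 0, q + s • (z - q) ∈ U := by
    have : Continuous fun s : ℝ => q + s • (z - q) := by fun_prop
    refine (this.tendsto 0).mono_left nhdsWithin_le_nhds (h.isOpen.mem_nhds ?_)
    simpa using hq
  obtain ⟨s, ⟨hs1, hs2⟩, hs3⟩ := ((h1.and h2).and (Ioo_mem_nhdsGT zero_lt_one)).exists
  have hmem : q + s • (z - q) ∈ Ω := by
    have := hc.openSegment_closure_interior_subset_interior (frontier_subset_closure hqf)
      (by rwa [ho.interior_eq] : z ∈ interior Ω)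
    rw [ho.interior_eq] at this
    apply this
    rw [openSegment_eq_image']
    exact ⟨s, hs3, rfl⟩
  have := (h.neg_iff hs2).2 hmem
  simp only [Pi.neg_apply] at hs1
  rw [h.eq_zero ho hq hqf] at hs1
  linarith

theorem gradient_ne_zero_iff {ρ : EuclideanSpace ℝ (Fin d) → ℝ} :
    gradient ρ q ≠ 0 ↔ fderiv ℝ ρ q ≠ 0 := by
  simp [gradient]

/-- The function `ρ` is also a defining function at the boundary points of `U` other than `p` where
its gradient is nonzero, so tangency can be used at neighbours of `p`. -/
theorem IsC2DefiningFunction.fderiv_apply_eq_zero (h : IsC2DefiningFunction Ω p U ρ)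
    (hq : q ∈ U) (hqf : q ∈ frontier Ω) (hne : fderiv ℝ ρ q ≠ 0)
    {v : EuclideanSpace ℝ (Fin d) → EuclideanSpace ℝ (Fin d)}
    (hvn : ∀ p ∈ frontier Ω, ∀ n, IsUnitOutwardNormal Ω p n → inner ℝ (v p) n = 0) :
    fderiv ℝ ρ q (v q) = 0 := by
  have hne' := gradient_ne_zero_iff.2 hne
  have h1 := hvn q hqf _ ⟨U, ρ, ⟨h.isOpen, hq, h.contDiffOn, h.inter_eq, hne'⟩, rfl⟩
  rw [inner_smul_right, mul_eq_zero, inv_eq_zero, norm_eq_zero] at h1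
  have h2 := h1.resolve_left hne'
  rw [real_inner_comm] at h2
  simpa [gradient] using h2

/-- If `Dρ(y) u < 0` then `y + s u ∈ Ω` for small `s > 0`, so `ℓ ≤ 0` on the open half-space `Dρ(y)
< 0`; such functionals are the nonnegative multiples of `Dρ(y)`. -/
theorem IsC2DefiningFunction.exists_eq_smul (h : IsC2DefiningFunction Ω y U ρ) (ho : IsOpen Ω)
    (hyf : y ∈ frontier Ω) {ℓ : EuclideanSpace ℝ (Fin d) →L[ℝ] ℝ}
    (hℓ : ∀ z ∈ Ω, ℓ (z - y) ≤ 0) : ∃ c : ℝ, 0 ≤ c ∧ ℓ = c • fderiv ℝ ρ y := by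
  set N := fderiv ℝ ρ y with hN
  have hneg : ∀ u, N u < 0 → ℓ u ≤ 0 := by
    intro u hu
    have h1 := (h.hasFDerivAt h.mem).eventually_lt_add_smul hu
    have h2 : ∀ᶠ s : ℝ in 𝓝[>] 0, y + s • u ∈ U := by
      have : Continuous fun s : ℝ => y + s • u := by fun_prop
      refine (this.tendsto 0).mono_left nhdsWithin_le_nhds (h.isOpen.mem_nhds ?_)
      simpa using h.mem
    obtain ⟨s, ⟨hs1, hs2⟩, hs3⟩ := ((h1.and h2).and self_mem_nhdsWithin).exists
    have hs3 : 0 < s := hs3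
    rw [h.eq_zero ho h.mem hyf, h.neg_iff hs2] at hs1
    have := hℓ _ hs1
    rw [add_sub_cancel_left, map_smul, smul_eq_mul] at this
    exact nonpos_of_mul_nonpos_right this hs3
  have hN0 : N ≠ 0 := gradient_ne_zero_iff.1 h.gradient_ne_zero
  obtain ⟨w, hw⟩ : ∃ w, N w ≠ 0 := by
    by_contra! hall
    exact hN0 (ContinuousLinearMap.ext hall)
  set u₀ := -(N w)⁻¹ • w with hu₀
  have hNu₀ : N u₀ = -1 := by
    rw [hu₀, map_smul, smul_eq_mul, neg_mul, inv_mul_cancel₀ hw]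
  have hker : ∀ u, N u = 0 → ℓ u ≤ 0 := by
    intro u hu
    refine le_of_forall_pos_le_add fun ε hε => ?_
    have hpos : 0 < ε / (1 + |ℓ u₀|) := by positivity
    have := hneg (u + (ε / (1 + |ℓ u₀|)) • u₀) (by
      rw [map_add, map_smul, hu, hNu₀, smul_eq_mul]; linarith)
    rw [map_add, map_smul, smul_eq_mul] at this
    have h2 : -(ε / (1 + |ℓ u₀|) * ℓ u₀) ≤ ε := by
      calc -(ε / (1 + |ℓ u₀|) * ℓ u₀) = ε / (1 + |ℓ u₀|) * (-ℓ u₀) := by ring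
        _ ≤ ε / (1 + |ℓ u₀|) * (1 + |ℓ u₀|) := by
          gcongr
          linarith [neg_abs_le (ℓ u₀)]
        _ = ε := by field_simp
    linarith
  refine ⟨-ℓ u₀, by linarith [hneg u₀ (by rw [hNu₀]; norm_num)], ?_⟩
  ext u
  have hk : N (u + N u • u₀) = 0 := by
    rw [map_add, map_smul, hNu₀, smul_eq_mul]; ring
  have h1 := hker _ hk
  have h2 := hker (-(u + N u • u₀)) (by rw [map_neg, hk, neg_zero])
  rw [map_neg] at h2
  rw [map_add, map_smul, smul_eq_mul] at h1 h2
  change ℓ u = -ℓ u₀ * N u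
  linarith

/-- Stands in for a boundary curve with velocity `u`. With `Dρ(y) w < 0`, the point `y + s (u + c
w)` is in `Ω` and `y + s (u - c w)` is not, so the segment between them crosses the frontier. -/
theorem IsC2DefiningFunction.exists_frontier_near (h : IsC2DefiningFunction Ω y U ρ)
    (ho : IsOpen Ω) (hyf : y ∈ frontier Ω) {u : EuclideanSpace ℝ (Fin d)}
    (hu : fderiv ℝ ρ y u = 0) {ε : ℝ} (hε : 0 < ε) {V : Set (EuclideanSpace ℝ (Fin d))}
    (hV : V ∈ 𝓝 y) :
    ∃ s : ℝ, 0 < s ∧ ∃ q ∈ frontier Ω, q ∈ V ∧ ‖q - y - s • u‖ ≤ ε * s := by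
  set N := fderiv ℝ ρ y with hN
  have hN0 : N ≠ 0 := gradient_ne_zero_iff.1 h.gradient_ne_zero
  obtain ⟨w, hw⟩ : ∃ w, N w < 0 := by
    by_contra! hall
    refine hN0 (ContinuousLinearMap.ext fun w => le_antisymm ?_ (hall w))
    have := hall (-w)
    rw [map_neg] at this
    change N w ≤ 0
    linarith
  set c : ℝ := ε / (1 + ‖w‖) with hc
  have hc0 : 0 < c := by positivity
  have hcw : c * ‖w‖ ≤ ε := by
    rw [hc, div_mul_eq_mul_div, div_le_iff₀ (by positivity)]
    nlinarith [norm_nonneg w]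
  have h1 := (h.hasFDerivAt h.mem).eventually_lt_add_smul (u := u + c • w) (by
    rw [map_add, map_smul, hu, zero_add, smul_eq_mul]; exact mul_neg_of_pos_of_neg hc0 hw)
  have h2 := (h.hasFDerivAt h.mem).neg.eventually_lt_add_smul (u := u + (-c) • w) (by
    change -(N (u + (-c) • w)) < 0
    rw [map_add, map_smul, hu, zero_add, smul_eq_mul]
    nlinarith)
  have h3 : ∀ᶠ s : ℝ in 𝓝[>] 0, Metric.closedBall y (s * (‖u‖ + ε)) ⊆ V ∩ U := by
    obtain ⟨r, hr, hrV⟩ := Metric.mem_nhds_iff.1 (inter_mem hV (h.isOpen.mem_nhds h.mem))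
    have : Continuous fun s : ℝ => s * (‖u‖ + ε) := by fun_prop
    have ht := (this.tendsto 0).mono_left (nhdsWithin_le_nhds (s := Ioi 0))
    rw [zero_mul] at ht
    filter_upwards [ht.eventually_lt_const hr] with s hs
    exact (Metric.closedBall_subset_ball hs).trans hrV
  obtain ⟨s, ⟨⟨hs1, hs2⟩, hs3⟩, hs0⟩ := (((h1.and h2).and h3).and self_mem_nhdsWithin).exists
  have hs0 : 0 < s := hs0
  have hball : ∀ τ ∈ Icc (-c) c, y + s • (u + τ • w) ∈ V ∩ U := by
    intro τ hτ
    apply hs3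
    rw [Metric.mem_closedBall, dist_eq_norm, add_sub_cancel_left, norm_smul,
      Real.norm_of_nonneg hs0.le]
    gcongr
    refine (norm_add_le _ _).trans ?_
    gcongr
    rw [norm_smul]
    refine le_trans ?_ hcw
    gcongr
    exact abs_le.2 hτ
  have hconn : IsPreconnected ((fun τ : ℝ => y + s • (u + τ • w)) '' Icc (-c) c) :=
    isPreconnected_Icc.image _ (by fun_prop)
  have hcm : c ∈ Icc (-c) c := ⟨by linarith, le_rfl⟩
  have hcm' : -c ∈ Icc (-c) c := ⟨le_rfl, by linarith⟩
  have hy0 := h.eq_zero ho h.mem hyf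
  obtain ⟨_, ⟨τ, hτ, rfl⟩, hq⟩ := hconn.exists_mem_frontier ho ⟨c, hcm, rfl⟩
    ((h.neg_iff (hball c hcm).2).1 (by rw [← hy0]; exact hs1)) ⟨-c, hcm', rfl⟩
    (fun hmem => by
      have := (h.neg_iff (hball _ hcm').2).2 hmem
      simp only [Pi.neg_apply, hy0] at hs2
      linarith)
  refine ⟨s, hs0, _, hq, (hball τ hτ).1, ?_⟩
  rw [add_sub_cancel_left, smul_add, add_sub_cancel_left, norm_smul, norm_smul,
    Real.norm_of_nonneg hs0.le, mul_comm]
  gcongr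
  refine le_trans ?_ hcw
  gcongr
  exact abs_le.2 hτ

/-- At a boundary point of a convex domain, the acceleration `Dv v` of a tangential field does not
point outwards. -/
theorem IsC2DefiningFunction.fderiv_acceleration_nonpos (h : IsC2DefiningFunction Ω y U ρ)
    (ho : IsOpen Ω) (hc : Convex ℝ Ω) (hyf : y ∈ frontier Ω)
    {v : EuclideanSpace ℝ (Fin d) → EuclideanSpace ℝ (Fin d)}
    (hvn : ∀ p ∈ frontier Ω, ∀ n, IsUnitOutwardNormal Ω p n → inner ℝ (v p) n = 0)
    {A : EuclideanSpace ℝ (Fin d) →L[ℝ] EuclideanSpace ℝ (Fin d)}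
    (hA : HasFDerivWithinAt v A (closure Ω) y) : fderiv ℝ ρ y (A (v y)) ≤ 0 := by
  set N := fderiv ℝ ρ y with hN
  set u := v y with hu
  have hN0 : N ≠ 0 := gradient_ne_zero_iff.1 h.gradient_ne_zero
  have hNu : N u = 0 := h.fderiv_apply_eq_zero h.mem hyf hN0 hvn
  have hC1 : ContDiffAt ℝ 1 (fderiv ℝ ρ) y := (h.contDiffAt h.mem).fderiv_right (by norm_num)
  obtain ⟨L, t, ht, hL⟩ := hC1.exists_lipschitzOnWith
  have hcont : ContinuousAt (fderiv ℝ ρ) y := hC1.continuousAt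
  -- Collects the coefficients of `ε` from the four error estimates `hd1'`, `hd2`, `hd3`, `hd4`.
  set B : ℝ := L * (‖u‖ + 1) + (‖N‖ + 1) * ‖A‖ + (‖N‖ + 1) * (‖u‖ + 1) + ‖A u‖ with hB
  suffices hkey : ∀ ε : ℝ, 0 < ε → ε ≤ 1 → N (A u) ≤ ε * B by
    have hB0 : 0 ≤ B := by positivity
    refine le_of_forall_pos_le_add fun η hη => ?_
    have hpos : 0 < min 1 (η / (B + 1)) := by positivity
    refine (hkey _ hpos (min_le_left _ _)).trans ?_
    rw [zero_add]
    calc min 1 (η / (B + 1)) * B ≤ η / (B + 1) * (B + 1) := by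
          gcongr
          · exact min_le_right _ _
          · linarith
      _ = η := by field_simp
  intro ε hε hε1
  have hv := hA.isLittleO.def hε
  rw [eventually_nhdsWithin_iff] at hv
  have hne : ∀ᶠ q in 𝓝 y, fderiv ℝ ρ q ≠ 0 := hcont.eventually_ne hN0
  have hclose : ∀ᶠ q in 𝓝 y, dist (fderiv ℝ ρ q) N ≤ ε :=
    (hcont.eventually (Metric.closedBall_mem_nhds _ hε))
  obtain ⟨s, hs, q, hqf, hqV, hr⟩ := h.exists_frontier_near ho hyf hNu hε
    (((hv.and hne).and hclose).and (Filter.inter_mem ht (h.isOpen.mem_nhds h.mem)))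
  obtain ⟨⟨⟨hvq, hq0⟩, hqε⟩, hqt, hqU⟩ := hqV
  have hvq := hvq (frontier_subset_closure hqf)
  set Nq := fderiv ℝ ρ q with hNq
  rw [dist_eq_norm] at hqε
  have hLq : ‖Nq - N‖ ≤ L * ‖q - y‖ := by
    have := hL.dist_le_mul q hqt y (mem_of_mem_nhds ht)
    rwa [dist_eq_norm, dist_eq_norm] at this
  set r := q - y - s • u with hrdef
  set o := v q - v y - A (q - y) with hodef
  have hqy : q - y = s • u + r := by rw [hrdef]; abel
  have hqyn : ‖q - y‖ ≤ s * (‖u‖ + 1) := by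
    rw [hqy]
    refine (norm_add_le _ _).trans ?_
    rw [norm_smul, Real.norm_of_nonneg hs.le]
    nlinarith
  have hNqn : ‖Nq‖ ≤ ‖N‖ + 1 := by
    have : ‖Nq‖ ≤ ‖N‖ + ‖Nq - N‖ := by simpa using norm_add_le N (Nq - N)
    linarith
  have hvq0 : Nq (v q) = 0 := h.fderiv_apply_eq_zero hqU hqf hq0 hvn
  have hexp : v q = u + s • A u + A r + o := by
    rw [hodef, hqy, map_add, map_smul, hu]; abel
  rw [hexp, map_add, map_add, map_add, map_smul, smul_eq_mul] at hvq0
  -- Each boundary point lies in the supporting half-space at the other. Adding the two gives `(Nq -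
  -- N) (q - y) ≥ 0`, a discrete form of the nonnegativity of the second fundamental form.
  have hmono1 : Nq (y - q) ≤ 0 :=
    h.fderiv_sub_nonpos ho hc hqU hqf (frontier_subset_closure hyf)
  have hmono2 : N (q - y) ≤ 0 :=
    h.fderiv_sub_nonpos ho hc h.mem hyf (frontier_subset_closure hqf)
  have hab : ∀ (T : EuclideanSpace ℝ (Fin d) →L[ℝ] ℝ) z, |T z| ≤ ‖T‖ * ‖z‖ := fun T z =>
    T.le_opNorm z
  -- Since `N u = 0`, `s * Nq u` equals the monotone term minus `(Nq - N) r`, where `Nq - N` is of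
  -- order `s` and `r` of order `ε s`. Thus `-(Nq u)` is at most of order `ε s`, which survives the
  -- division of `Nq (v q) = 0` by `s`.
  have hd1 : s * -(Nq u) ≤ s * (ε * (L * (‖u‖ + 1)) * s) := by
    have e1 : s * -(Nq u) = -((Nq - N) (q - y)) + (Nq - N) r := by
      rw [hqy, map_add, map_smul, smul_eq_mul]
      simp [hNu]
      ring
    have e2 : 0 ≤ (Nq - N) (q - y) := by
      have : Nq (y - q) = -(Nq (q - y)) := by rw [← map_neg, neg_sub]
      change 0 ≤ Nq (q - y) - N (q - y)
      linarith
    have e3 : (Nq - N) r ≤ (L * (s * (‖u‖ + 1))) * (ε * s) :=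
      (le_abs_self _).trans ((hab _ _).trans (by
        gcongr
        exact hLq.trans (by gcongr)))
    rw [e1]
    calc _ ≤ (L * (s * (‖u‖ + 1))) * (ε * s) := by linarith
      _ = _ := by ring
  have hd1' : -(Nq u) ≤ ε * (L * (‖u‖ + 1)) * s := le_of_mul_le_mul_left hd1 hs
  have hd2 : -(Nq (A r)) ≤ (‖N‖ + 1) * (‖A‖ * (ε * s)) :=
    (neg_le_abs _).trans ((hab _ _).trans (by
      gcongr
      exact (A.le_opNorm r).trans (by gcongr)))
  have hd3 : -(Nq o) ≤ (‖N‖ + 1) * (ε * (s * (‖u‖ + 1))) :=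
    (neg_le_abs _).trans ((hab _ _).trans (by
      gcongr
      exact hvq.trans (by gcongr)))
  have hd4 : N (A u) - Nq (A u) ≤ ε * ‖A u‖ := by
    have : N (A u) - Nq (A u) = -((Nq - N) (A u)) := by
      change _ = -(Nq (A u) - N (A u)); ring
    rw [this]
    exact (neg_le_abs _).trans ((hab _ _).trans (by gcongr))
  have hd5 : s * Nq (A u) ≤ s * (ε * (L * (‖u‖ + 1) + (‖N‖ + 1) * ‖A‖ +
      (‖N‖ + 1) * (‖u‖ + 1))) := by
    calc s * Nq (A u) = -(Nq u) + -(Nq (A r)) + -(Nq o) := by linarith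
      _ ≤ ε * (L * (‖u‖ + 1)) * s + (‖N‖ + 1) * (‖A‖ * (ε * s)) +
          (‖N‖ + 1) * (ε * (s * (‖u‖ + 1))) := by gcongr
      _ = _ := by ring
  have hd6 := le_of_mul_le_mul_left hd5 hs
  rw [hB]
  linarith

end DefiningFunction

/-! ### Pointwise identities for `w` and `∇g`. -/

/-- The trace of an endomorphism of Euclidean space, as a continuous linear functional. -/
noncomputable def traceCLM (d : ℕ) :
    (EuclideanSpace ℝ (Fin d) →L[ℝ] EuclideanSpace ℝ (Fin d)) →L[ℝ] ℝ :=
  ∑ i, (EuclideanSpace.proj i : EuclideanSpace ℝ (Fin d) →L[ℝ] ℝ) ∘L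
    ContinuousLinearMap.apply ℝ (EuclideanSpace ℝ (Fin d)) (EuclideanSpace.single i (1 : ℝ))

theorem traceCLM_apply {d : ℕ} (L : EuclideanSpace ℝ (Fin d) →L[ℝ] EuclideanSpace ℝ (Fin d)) :
    traceCLM d L = ∑ i, L (EuclideanSpace.single i 1) i := by
  simp [traceCLM]

theorem sum_smul_single {d : ℕ} (u : EuclideanSpace ℝ (Fin d)) :
    ∑ i, u i • EuclideanSpace.single i (1 : ℝ) = u := by
  ext j
  simp [Pi.single_apply]

section Calculus

variable {d : ℕ} {v w : EuclideanSpace ℝ (Fin d) → EuclideanSpace ℝ (Fin d)}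
  {x : EuclideanSpace ℝ (Fin d)}

theorem partialD_eq (hv : DifferentiableAt ℝ v x) (i j : Fin d) :
    partialD v i j x = fderiv ℝ v x (EuclideanSpace.single j 1) i := by
  have h : HasFDerivAt (fun y => v y i)
      ((EuclideanSpace.proj i : EuclideanSpace ℝ (Fin d) →L[ℝ] ℝ) ∘L fderiv ℝ v x) x :=
    (EuclideanSpace.proj i : EuclideanSpace ℝ (Fin d) →L[ℝ] ℝ).hasFDerivAt.comp x hv.hasFDerivAt
  rw [partialD, h.fderiv]
  rfl

theorem divergence_eq (hv : DifferentiableAt ℝ v x) :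
    divergence v x = traceCLM d (fderiv ℝ v x) := by
  rw [traceCLM_apply, divergence]
  exact Finset.sum_congr rfl fun i _ => partialD_eq hv i i

theorem divergence_smul {a : EuclideanSpace ℝ (Fin d) → ℝ} (ha : DifferentiableAt ℝ a x)
    (hw : DifferentiableAt ℝ w x) :
    divergence (fun y => a y • w y) x = fderiv ℝ a x (w x) + a x * divergence w x := by
  rw [divergence_eq (ha.fun_smul hw), divergence_eq hw, fderiv_fun_smul ha hw, map_add, map_smul,
    smul_eq_mul, add_comm]
  congr 1
  rw [traceCLM_apply]
  conv_rhs => rw [← sum_smul_single (w x), map_sum]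
  refine Finset.sum_congr rfl fun i _ => ?_
  simp [mul_comm]

theorem fderiv_apply_apply (hv : DifferentiableAt ℝ v x) (u : EuclideanSpace ℝ (Fin d))
    (i : Fin d) : fderiv ℝ v x u i = ∑ j, partialD v i j x * u j := by
  conv_lhs => rw [← sum_smul_single u, map_sum]
  simp [partialD_eq hv, mul_comm]

/-- The divergence of the field `Dv v - (div v) v`. -/
theorem divergence_acceleration_sub (hv : ContDiffAt ℝ 2 v x) :
    divergence (fun y => fderiv ℝ v y (v y) - traceCLM d (fderiv ℝ v y) • v y) x =
      ∑ i, ∑ j, partialD v i j x * partialD v j i x - |divergence v x| ^ 2 := by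
  have hvd : DifferentiableAt ℝ v x := hv.differentiableAt (by norm_num)
  have hDd : DifferentiableAt ℝ (fderiv ℝ v) x :=
    (hv.fderiv_right (m := 1) (by norm_num)).differentiableAt (by norm_num)
  have hsymm : IsSymmSndFDerivAt ℝ v x := hv.isSymmSndFDerivAt (by simp)
  set D := fderiv ℝ v x with hD
  set D' := fderiv ℝ (fderiv ℝ v) x with hD'
  have hd : HasFDerivAt (fun y => fderiv ℝ v y (v y) - traceCLM d (fderiv ℝ v y) • v y)
      ((D.comp D + D'.flip (v x)) - (traceCLM d D • D +
        ((traceCLM d).comp D').smulRight (v x))) x := by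
    have h1 := hDd.hasFDerivAt.clm_apply hvd.hasFDerivAt
    have h2 := ((traceCLM d).hasFDerivAt.comp x hDd.hasFDerivAt).smul hvd.hasFDerivAt
    exact h1.sub h2
  rw [divergence_eq hd.differentiableAt, hd.fderiv, map_sub, map_add, map_add, map_smul,
    smul_eq_mul]
  -- Symmetry of the second derivative: the trace of `u ↦ D'(u)(v)` equals the derivative of `div v`
  -- along `v`, so the second-order terms cancel.
  have e1 : D'.flip (v x) = D' (v x) := by
    ext1 u
    exact hsymm.eq u (v x)
  have e2 : traceCLM d (((traceCLM d).comp D').smulRight (v x)) = traceCLM d (D' (v x)) := by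
    rw [traceCLM_apply]
    conv_rhs => rw [← sum_smul_single (v x), map_sum, map_sum]
    refine Finset.sum_congr rfl fun i _ => ?_
    simp [mul_comm]
  have e3 : traceCLM d (D.comp D) = ∑ i, ∑ j, partialD v i j x * partialD v j i x := by
    rw [traceCLM_apply]
    refine Finset.sum_congr rfl fun i _ => ?_
    rw [ContinuousLinearMap.comp_apply, hD, fderiv_apply_apply hvd]
    refine Finset.sum_congr rfl fun j _ => ?_
    rw [partialD_eq hvd j i]
  rw [e1, e2, e3, sq_abs, divergence_eq hvd]
  ring

theorem fderiv_norm_sq_comp_apply (hv : DifferentiableAt ℝ v x) (u : EuclideanSpace ℝ (Fin d)) :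
    fderiv ℝ (fun y => ‖v y‖ ^ 2) x u = 2 * inner ℝ (v x) (fderiv ℝ v x u) := by
  rw [hv.hasFDerivAt.norm_sq.fderiv]
  simp

theorem norm_le_curlNorm_mul_norm {z : EuclideanSpace ℝ (Fin d)}
    (hz : ∀ j, z j = ∑ i, (partialD v i j x - partialD v j i x) * v x i) :
    ‖z‖ ≤ curlNorm v x * ‖v x‖ := by
  rw [EuclideanSpace.norm_eq z, curlNorm, EuclideanSpace.norm_eq (v x),
    ← Real.sqrt_mul (Finset.sum_nonneg fun i _ => Finset.sum_nonneg fun j _ => by positivity)]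
  refine Real.sqrt_le_sqrt ?_
  rw [Finset.sum_comm, Finset.sum_mul]
  refine Finset.sum_le_sum fun j _ => ?_
  rw [hz j, Real.norm_eq_abs, sq_abs]
  simp only [sq_abs, Real.norm_eq_abs]
  exact Finset.sum_mul_sq_le_sq_mul_sq _ _ _

/-- The vector `z = (Dv)ᵀ v - Dv v` is a curl matrix applied to `v`, so `|z| ≤ curlNorm v * |v|`.
Substituting `Dv v = ∇g / 2 - z` into `∇g · w` and using Cauchy–Schwarz on the two remaining terms
gives the bound. -/
theorem gradient_norm_sq_estimate (hv : DifferentiableAt ℝ v x)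
    {g : EuclideanSpace ℝ (Fin d) → ℝ} (hg : ∀ x, g x = ‖v x‖ ^ 2) :
    ‖gradient g x‖ * ‖gradient g x‖ -
        2 * √(g x) * ((curlNorm v x + |divergence v x|) * ‖gradient g x‖) ≤
      2 * fderiv ℝ g x (fderiv ℝ v x (v x) - traceCLM d (fderiv ℝ v x) • v x) := by
  obtain rfl : g = fun y => ‖v y‖ ^ 2 := funext hg
  set G := gradient (fun y => ‖v y‖ ^ 2) x with hG
  have hGu : ∀ u, inner ℝ G u = fderiv ℝ (fun y => ‖v y‖ ^ 2) x u := fun u => by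
    simp [hG, gradient]
  set z : EuclideanSpace ℝ (Fin d) := (2 : ℝ)⁻¹ • G - fderiv ℝ v x (v x) with hz
  have hGj : ∀ j, G j = 2 * ∑ i, partialD v i j x * v x i := by
    intro j
    have h1 := hGu (EuclideanSpace.single j 1)
    rw [fderiv_norm_sq_comp_apply hv] at h1
    have h2 : inner ℝ G (EuclideanSpace.single j (1 : ℝ)) = G j := by
      simp [EuclideanSpace.inner_single_right]
    rw [← h2, h1, PiLp.inner_apply]
    congr 1
    refine Finset.sum_congr rfl fun i _ => ?_
    rw [partialD_eq hv]
    simp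
  have hzn : ‖z‖ ≤ curlNorm v x * ‖v x‖ := by
    refine norm_le_curlNorm_mul_norm fun j => ?_
    have : z j = 2⁻¹ * G j - fderiv ℝ v x (v x) j := by simp [hz]
    rw [this, hGj, fderiv_apply_apply hv, ← mul_assoc, inv_mul_cancel₀ two_ne_zero, one_mul,
      ← Finset.sum_sub_distrib]
    refine Finset.sum_congr rfl fun i _ => ?_
    ring
  have hDv : fderiv ℝ v x (v x) = (2 : ℝ)⁻¹ • G - z := by rw [hz]; abel
  have hsq : √(‖v x‖ ^ 2) = ‖v x‖ := Real.sqrt_sq (norm_nonneg _)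
  have hexp : 2 * fderiv ℝ (fun y => ‖v y‖ ^ 2) x
      (fderiv ℝ v x (v x) - traceCLM d (fderiv ℝ v x) • v x) =
      ‖G‖ * ‖G‖ - 2 * inner ℝ G z - 2 * divergence v x * inner ℝ G (v x) := by
    rw [← hGu, inner_sub_right, hDv, inner_sub_right, inner_smul_right, inner_smul_right,
      real_inner_self_eq_norm_mul_norm, divergence_eq hv]
    ring
  have hcs1 : inner ℝ G z ≤ ‖G‖ * (curlNorm v x * ‖v x‖) :=
    (real_inner_le_norm _ _).trans (by gcongr)
  have hcs2 : divergence v x * inner ℝ G (v x) ≤ |divergence v x| * (‖G‖ * ‖v x‖) := by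
    refine (le_abs_self _).trans ?_
    rw [abs_mul]
    gcongr
    exact abs_real_inner_le_norm _ _
  change ‖G‖ * ‖G‖ - 2 * √(‖v x‖ ^ 2) * ((curlNorm v x + |divergence v x|) * ‖G‖) ≤ _
  rw [hsq, hexp]
  nlinarith

end Calculus

/-! ### Test functions, level integrals and superlevel integrals. -/

/-- Thickened indicators tend to the indicator of a closed set, so `F` has nonnegative integral over
every closed set. Were `F` negative on a set of positive measure, inner regularity would give a
compact such set. -/
theorem ae_nonneg_of_forall_continuous_integral_nonneg {α : Type*} [MetricSpace α]
    [MeasurableSpace α] [BorelSpace α] {μ : Measure α} [μ.InnerRegular]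
    {F : α → ℝ} (hF : Integrable F μ)
    (h : ∀ ψ : α → ℝ, Continuous ψ → (∀ t, 0 ≤ ψ t) → (∀ t, ψ t ≤ 1) → 0 ≤ ∫ t, ψ t * F t ∂μ) :
    0 ≤ᵐ[μ] F := by
  have hcl : ∀ S : Set α, IsClosed S → 0 ≤ ∫ t in S, F t ∂μ := by
    intro S hS
    have hpos : ∀ n : ℕ, (0 : ℝ) < 1 / ((n : ℝ) + 1) := fun n => by positivity
    have hlim := thickenedIndicator_tendsto_indicator_closure hpos
      tendsto_one_div_add_atTop_nhds_zero_nat S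
    rw [tendsto_pi_nhds] at hlim
    have ht : Tendsto (fun n : ℕ => ∫ t, (thickenedIndicator (hpos n) S t : ℝ) * F t ∂μ) atTop
        (𝓝 (∫ t, S.indicator F t ∂μ)) := by
      refine tendsto_integral_of_dominated_convergence (fun t => ‖F t‖) (fun n => ?_) hF.norm
        (fun n => Eventually.of_forall fun t => ?_) (Eventually.of_forall fun t => ?_)
      · refine AEStronglyMeasurable.mul (Continuous.aestronglyMeasurable ?_) hF.aestronglyMeasurable
        exact NNReal.continuous_coe.comp (thickenedIndicator (hpos n) S).continuous
      · rw [norm_mul]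
        refine mul_le_of_le_one_left (norm_nonneg _) ?_
        rw [Real.norm_of_nonneg (NNReal.coe_nonneg _)]
        exact_mod_cast thickenedIndicator_le_one (hpos n) S t
      · have h1 := ((NNReal.continuous_coe.tendsto _).comp (hlim t)).mul_const (F t)
        rw [hS.closure_eq] at h1
        have h2 : ((S.indicator (fun _ => (1 : ℝ≥0)) t : ℝ≥0) : ℝ) * F t = S.indicator F t := by
          by_cases hts : t ∈ S
          · rw [indicator_of_mem hts, indicator_of_mem hts]; simp
          · rw [indicator_of_notMem hts, indicator_of_notMem hts]; simp
        rw [h2] at h1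
        exact h1
    rw [integral_indicator hS.measurableSet] at ht
    refine ge_of_tendsto' ht fun n => h _ ?_ (fun t => NNReal.coe_nonneg _) (fun t => ?_)
    · exact NNReal.continuous_coe.comp (thickenedIndicator (hpos n) S).continuous
    · exact_mod_cast thickenedIndicator_le_one (hpos n) S t
  by_contra hneg
  have hA : NullMeasurableSet {t | F t < 0} μ :=
    nullMeasurableSet_lt hF.aestronglyMeasurable.aemeasurable aemeasurable_const
  obtain ⟨B, hBA, hBm, hBe⟩ := hA.exists_measurable_subset_ae_eq
  have hB0 : 0 < μ B := by
    rw [measure_congr hBe, pos_iff_ne_zero]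
    intro h0
    refine hneg ?_
    filter_upwards [measure_eq_zero_iff_ae_notMem.1 h0] with t ht using not_lt.1 ht
  obtain ⟨S, hSB, hSc, hS0⟩ := hBm.exists_lt_isCompact hB0
  have hS := hSc.isClosed
  have hFneg : ∀ t ∈ S, F t < 0 := fun t ht => hBA (hSB ht)
  have h1 := hcl S hS
  have h2 : 0 < ∫ t in S, -F t ∂μ := by
    rw [setIntegral_pos_iff_support_of_nonneg_ae]
    · refine hS0.trans_le (measure_mono fun t ht => ⟨?_, ht⟩)
      rw [Function.mem_support]
      exact neg_ne_zero.2 (hFneg t ht).ne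
    · refine (ae_restrict_iff' hS.measurableSet).2 (Eventually.of_forall fun t ht => ?_)
      exact neg_nonneg.2 (hFneg t ht).le
    · exact hF.neg.integrableOn
  rw [integral_neg] at h2
  linarith

theorem measurable_indicator_of_continuousOn {α : Type*} [TopologicalSpace α] [MeasurableSpace α]
    [OpensMeasurableSpace α] {s : Set α} (hs : MeasurableSet s) {f : α → ℝ}
    (hf : ContinuousOn f s) : Measurable (s.indicator f) := by
  classical
  have := hf.measurable_piecewise (continuousOn_const (c := (0 : ℝ)) (s := sᶜ)) hs
  simpa [piecewise_eq_indicator] using! this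

theorem measurable_norm_gradient {d : ℕ} (g : EuclideanSpace ℝ (Fin d) → ℝ) :
    Measurable fun x => ‖gradient g x‖ := by
  have h2 : (fun x => ‖gradient g x‖) = fun x => ‖fderiv ℝ g x‖ := by
    ext x
    simp [gradient]
  rw [h2]
  exact (measurable_fderiv ℝ g).norm

/-- Integration over the level sets of a function: the coarea formula, including the critical
points when these are negligible on almost every level set. -/
theorem level_integral {m : ℕ} {Ω : Set (EuclideanSpace ℝ (Fin (m + 1)))} (ho : IsOpen Ω)
    {g : EuclideanSpace ℝ (Fin (m + 1)) → ℝ} (hg : ContDiffOn ℝ 1 g Ω)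
    (hcrit : ∀ᵐ t : ℝ, μHE[m] ({x ∈ Ω | gradient g x = 0} ∩ {x | g x = t}) = 0)
    {f : EuclideanSpace ℝ (Fin (m + 1)) → ℝ} (hf : Measurable f) (hf0 : ∀ x, 0 ≤ f x)
    (hfi : IntegrableOn (fun x => f x * ‖gradient g x‖) Ω) :
    (∀ᵐ t : ℝ, IntegrableOn f {x ∈ Ω | g x = t} μHE[m]) ∧
    Integrable (fun t => ∫ x in {x ∈ Ω | g x = t}, f x ∂μHE[m]) ∧
    ∀ ψ : ℝ → ℝ, Measurable ψ → (∀ t, 0 ≤ ψ t) →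
      ∫ t, ψ t * ∫ x in {x ∈ Ω | g x = t}, f x ∂μHE[m] =
        ∫ x in Ω, ψ (g x) * (f x * ‖gradient g x‖) := by
  have hgat : ∀ x ∈ Ω, ContDiffAt ℝ 1 g x := fun x hx => hg.contDiffAt (ho.mem_nhds hx)
  have hGm := measurable_norm_gradient g
  set R : Set (EuclideanSpace ℝ (Fin (m + 1))) := Ω ∩ {x | ‖gradient g x‖ ≠ 0} with hR
  have hRm : MeasurableSet R :=
    ho.measurableSet.inter (hGm (measurableSet_singleton (0 : ℝ)).compl)
  have hco : ∀ {F : EuclideanSpace ℝ (Fin (m + 1)) → ℝ≥0∞}, Measurable F → _ := fun {F} hF =>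
    coarea_lintegral hRm (fun x hx => hgat x hx.1) (fun x hx => norm_ne_zero_iff.1 hx.2)
      (f := F) hF
  -- Nothing is known about `g` outside `Ω`; this modification is measurable on the whole space.
  set g' := Ω.indicator g with hg'
  have hg'm : Measurable g' := measurable_indicator_of_continuousOn ho.measurableSet hg.continuousOn
  have hg'R : ∀ x ∈ R, g' x = g x := fun x hx => indicator_of_mem hx.1 g
  have hfE : Measurable fun x => ENNReal.ofReal (f x) := hf.ennreal_ofReal
  set Λ : ℝ → ℝ≥0∞ := fun t => ∫⁻ x in R ∩ {x | g x = t}, ENNReal.ofReal (f x) ∂μHE[m] with hΛ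
  have hΛm : Measurable Λ := (hco hfE).1
  have hlvl : ∀ t, MeasurableSet (R ∩ {x | g x = t}) := by
    intro t
    have : R ∩ {x | g x = t} = R ∩ g' ⁻¹' {t} := by
      ext x
      constructor
      · rintro ⟨hx, hxt⟩
        exact ⟨hx, (hg'R x hx).trans hxt⟩
      · rintro ⟨hx, hxt⟩
        exact ⟨hx, (hg'R x hx).symm.trans hxt⟩
    rw [this]
    exact hRm.inter (hg'm (measurableSet_singleton t))
  have hRint : ∀ h : EuclideanSpace ℝ (Fin (m + 1)) → ℝ,
      ∫ x in Ω, h x * (f x * ‖gradient g x‖) = ∫ x in R, h x * (f x * ‖gradient g x‖) := by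
    intro h
    refine (setIntegral_eq_of_subset_of_forall_sdiff_eq_zero ho.measurableSet
      inter_subset_left fun x hx => ?_)
    have : ‖gradient g x‖ = 0 := by
      by_contra hne
      exact hx.2 ⟨hx.1, hne⟩
    rw [this, mul_zero, mul_zero]
  have hΛψ : ∀ ψ : ℝ → ℝ, Measurable ψ → (∀ t, 0 ≤ ψ t) →
      ∫⁻ t, ENNReal.ofReal (ψ t) * Λ t =
        ∫⁻ x in R, ENNReal.ofReal (ψ (g x) * (f x * ‖gradient g x‖)) := by
    intro ψ hψ hψ0
    have h1 := (hco (F := fun x => ENNReal.ofReal (ψ (g' x)) * ENNReal.ofReal (f x))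
      ((hψ.comp hg'm).ennreal_ofReal.mul hfE)).2
    have h2 : ∀ t, ∫⁻ x in R ∩ {x | g x = t},
        ENNReal.ofReal (ψ (g' x)) * ENNReal.ofReal (f x) ∂μHE[m] = ENNReal.ofReal (ψ t) * Λ t := by
      intro t
      rw [hΛ, ← lintegral_const_mul _ hfE]
      refine setLIntegral_congr_fun (hlvl t) fun x hx => ?_
      rw [hg'R x hx.1, show g x = t from hx.2]
    simp_rw [h2] at h1
    rw [h1]
    refine setLIntegral_congr_fun hRm fun x hx => ?_
    rw [hg'R x hx, ← ofReal_norm, ENNReal.ofReal_mul (hψ0 _),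
      ENNReal.ofReal_mul (hf0 _), mul_assoc]
  have hfE' : ∫⁻ t, Λ t = ∫⁻ x in R, ENNReal.ofReal (f x * ‖gradient g x‖) := by
    simpa using hΛψ (fun _ => 1) measurable_const fun _ => zero_le_one
  have hΛfin : ∫⁻ t, Λ t ≠ ∞ := by
    rw [hfE']
    exact ((hfi.mono_set inter_subset_left).lintegral_lt_top).ne
  have hΛae : ∀ᵐ t : ℝ, Λ t < ∞ := ae_lt_top hΛm hΛfin
  -- By `hcrit`, for almost every level the critical points may be dropped.
  have hres : ∀ᵐ t : ℝ, (μHE[m] : Measure (EuclideanSpace ℝ (Fin (m + 1)))).restrict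
      {x ∈ Ω | g x = t} = μHE[m].restrict (R ∩ {x | g x = t}) := by
    filter_upwards [hcrit] with t ht
    refine Measure.restrict_congr_set ?_
    refine EventuallyEq.symm (LE.le.eventuallyLE ?_ |>.antisymm ?_)
    · exact fun x hx => ⟨hx.1.1, hx.2⟩
    · rw [ae_le_set]
      refine measure_mono_null (fun x hx => ?_) ht
      obtain ⟨⟨hxΩ, hxt⟩, hxR⟩ := hx
      refine ⟨⟨hxΩ, ?_⟩, hxt⟩
      by_contra hne
      exact hxR ⟨⟨hxΩ, norm_ne_zero_iff.2 hne⟩, hxt⟩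
  have hI : ∀ᵐ t : ℝ, ∫ x in {x ∈ Ω | g x = t}, f x ∂μHE[m] = (Λ t).toReal := by
    filter_upwards [hres] with t ht
    rw [ht, integral_eq_lintegral_of_nonneg_ae (Eventually.of_forall hf0)
      hf.aestronglyMeasurable]
  refine ⟨?_, ?_, fun ψ hψ hψ0 => ?_⟩
  · filter_upwards [hres, hΛae] with t ht hΛt
    rw [IntegrableOn, ht]
    refine ⟨hf.aestronglyMeasurable, ?_⟩
    rw [hasFiniteIntegral_iff_ofReal (Eventually.of_forall hf0)]
    exact hΛt
  · refine (integrable_congr hI).2 ?_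
    exact integrable_toReal_of_lintegral_ne_top hΛm.aemeasurable hΛfin
  · have h1 : ∫ t, ψ t * ∫ x in {x ∈ Ω | g x = t}, f x ∂μHE[m] =
        ∫ t, (ENNReal.ofReal (ψ t) * Λ t).toReal := by
      refine integral_congr_ae ?_
      filter_upwards [hI] with t ht
      rw [ht, ENNReal.toReal_mul, ENNReal.toReal_ofReal (hψ0 t)]
    rw [h1, integral_toReal (f := fun t => ENNReal.ofReal (ψ t) * Λ t) (hψ.ennreal_ofReal.mul hΛm).aemeasurable, hΛψ ψ hψ hψ0, hRint,
      integral_eq_lintegral_of_nonneg_ae]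
    · exact Eventually.of_forall fun x =>
        mul_nonneg (hψ0 _) (mul_nonneg (hf0 x) (norm_nonneg _))
    · have : AEStronglyMeasurable (fun x => ψ (g' x) * (f x * ‖gradient g x‖))
          (volume.restrict R) :=
        ((hψ.comp hg'm).mul (hf.mul hGm)).aestronglyMeasurable
      refine this.congr ((ae_restrict_iff' hRm).2 (Eventually.of_forall fun x hx => ?_))
      simp only [hg'R x hx]
    · filter_upwards [hΛae] with t ht using ENNReal.mul_lt_top ENNReal.ofReal_lt_top ht

/-- A layer-cake formula for the integrals of `q` over the superlevel sets of `g`. -/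
theorem superlevel_integral {d : ℕ} {Ω : Set (EuclideanSpace ℝ (Fin d))} (ho : IsOpen Ω)
    {g q : EuclideanSpace ℝ (Fin d) → ℝ} (hg : ContinuousOn g Ω) {M : ℝ}
    (hg0 : ∀ x ∈ Ω, 0 ≤ g x) (hgM : ∀ x ∈ Ω, g x < M) (hq : IntegrableOn q Ω) :
    IntegrableOn (fun t => ∫ x in {x ∈ Ω | t < g x}, q x) (Ioi 0) ∧
    ∀ ψ : ℝ → ℝ, Continuous ψ → (∀ t, 0 ≤ ψ t) → (∀ t, ψ t ≤ 1) →
      ∫ t in Ioi 0, ψ t * ∫ x in {x ∈ Ω | t < g x}, q x =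
        ∫ x in Ω, q x * ∫ s in (0 : ℝ)..g x, ψ s := by
  have hΩm := ho.measurableSet
  set g' := Ω.indicator g with hg'
  have hg'm : Measurable g' := measurable_indicator_of_continuousOn hΩm hg
  have hg'Ω : ∀ x ∈ Ω, g' x = g x := fun x hx => indicator_of_mem hx g
  set S : Set (ℝ × EuclideanSpace ℝ (Fin d)) := {p | p.1 < g' p.2} with hS
  have hSm : MeasurableSet S := measurableSet_lt measurable_fst (hg'm.comp measurable_snd)
  have key : ∀ ψ : ℝ → ℝ, Continuous ψ → (∀ t, 0 ≤ ψ t) → (∀ t, ψ t ≤ 1) →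
      IntegrableOn (fun t => ψ t * ∫ x in {x ∈ Ω | t < g x}, q x) (Ioi 0) ∧
      ∫ t in Ioi 0, ψ t * ∫ x in {x ∈ Ω | t < g x}, q x =
        ∫ x in Ω, q x * ∫ s in (0 : ℝ)..g x, ψ s := by
    intro ψ hψ hψ0 hψ1
    -- Truncating `ψ` at `M` makes `k` integrable on the product and changes nothing, as `g < M` on
    -- `Ω`.
    set k : ℝ → EuclideanSpace ℝ (Fin d) → ℝ := fun t x =>
      S.indicator (fun p => (Iio M).indicator ψ p.1 * q p.2) (t, x) with hk
    have hψi : Integrable ((Iio M).indicator ψ) (volume.restrict (Ioi 0)) := by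
      rw [integrable_indicator_iff measurableSet_Iio, IntegrableOn,
        Measure.restrict_restrict measurableSet_Iio]
      refine Measure.integrableOn_of_bounded (M := 1) ?_ hψ.aestronglyMeasurable
        (Eventually.of_forall fun t => ?_)
      · rw [inter_comm, Ioi_inter_Iio]
        exact measure_Ioo_lt_top.ne
      · rw [Real.norm_of_nonneg (hψ0 t)]
        exact hψ1 t
    have hki : Integrable (Function.uncurry k)
        ((volume.restrict (Ioi 0)).prod (volume.restrict Ω)) :=
      (hψi.mul_prod hq).indicator hSm
    have hk1 : ∀ t, ∫ x in Ω, k t x = ψ t * ∫ x in {x ∈ Ω | t < g x}, q x := by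
      intro t
      have hset : {x ∈ Ω | t < g x} = Ω ∩ {x | t < g' x} := by
        ext x
        exact and_congr_right fun hx => by
          change t < g x ↔ t < g' x
          rw [hg'Ω x hx]
      have hm : MeasurableSet {x | t < g' x} := measurableSet_lt measurable_const hg'm
      have e : ∀ x, k t x = {x | t < g' x}.indicator (fun x => (Iio M).indicator ψ t * q x) x :=
        fun x => rfl
      simp_rw [e]
      rw [integral_indicator hm, Measure.restrict_restrict hm, integral_const_mul, hset, inter_comm]
      by_cases ht : t < M
      · rw [indicator_of_mem (show t ∈ Iio M from ht)]
      · have : Ω ∩ {x | t < g' x} = ∅ := by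
          rw [← hset]
          refine eq_empty_of_forall_notMem fun x hx => ?_
          have := hgM x hx.1
          have := hx.2
          linarith
        simp [this]
    have hk2 : ∀ x ∈ Ω, ∫ t in Ioi 0, k t x = q x * ∫ s in (0 : ℝ)..g x, ψ s := by
      intro x hx
      have e : ∀ t, k t x = (Iio (g x)).indicator (fun t => ψ t * q x) t := by
        intro t
        simp only [hk, hS]
        by_cases ht : t < g x
        · rw [indicator_of_mem (by change t < g' x; rwa [hg'Ω x hx]),
            indicator_of_mem (show t ∈ Iio (g x) from ht),
            indicator_of_mem (show t ∈ Iio M from ht.trans (hgM x hx))]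
        · rw [indicator_of_notMem (by change ¬ t < g' x; rwa [hg'Ω x hx]),
            indicator_of_notMem (show t ∉ Iio (g x) from ht)]
      simp_rw [e]
      rw [integral_indicator measurableSet_Iio, Measure.restrict_restrict measurableSet_Iio,
        inter_comm, Ioi_inter_Iio, integral_mul_const, mul_comm,
        intervalIntegral.integral_of_le (hg0 x hx), integral_Ioc_eq_integral_Ioo]
    refine ⟨?_, ?_⟩
    · have := hki.integral_prod_left
      simp only [Function.uncurry_apply_pair, hk1] at this
      exact this
    · have := integral_integral_swap hki
      simp only [hk1] at this
      rw [this]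
      exact setIntegral_congr_fun hΩm fun x hx => hk2 x hx
  refine ⟨?_, fun ψ h1 h2 h3 => (key ψ h1 h2 h3).2⟩
  simpa using (key (fun _ => 1) continuous_const (fun _ => zero_le_one) fun _ => le_rfl).1

/-! ### The acceleration field and the energy inequality. -/

theorem integrableOn_of_eqOn_continuousOn_closure {d : ℕ} {Ω : Set (EuclideanSpace ℝ (Fin d))}
    (ho : IsOpen Ω) (hb : Bornology.IsBounded Ω) {f F : EuclideanSpace ℝ (Fin d) → ℝ}
    (hF : ContinuousOn F (closure Ω)) (h : EqOn f F Ω) : IntegrableOn f Ω :=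
  (integrableOn_congr_fun h ho.measurableSet).2
    ((hF.integrableOn_compact hb.isCompact_closure).mono_set subset_closure)

section Field

variable {d : ℕ} {Ω : Set (EuclideanSpace ℝ (Fin d))}
  {v : EuclideanSpace ℝ (Fin d) → EuclideanSpace ℝ (Fin d)}

theorem uniqueDiffOn_closure (ho : IsOpen Ω) (hc : Convex ℝ Ω) (hne : Ω.Nonempty) :
    UniqueDiffOn ℝ (closure Ω) :=
  uniqueDiffOn_convex hc.closure (hne.mono (interior_maximal subset_closure ho))

theorem fderivWithin_closure_eq {F : Type*} [NormedAddCommGroup F] [NormedSpace ℝ F]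
    (ho : IsOpen Ω) {f : EuclideanSpace ℝ (Fin d) → F} {x : EuclideanSpace ℝ (Fin d)}
    (hx : x ∈ Ω) : fderivWithin ℝ f (closure Ω) x = fderiv ℝ f x :=
  fderivWithin_of_mem_nhds (mem_of_superset (ho.mem_nhds hx) subset_closure)

theorem ContDiffOn.contDiffAt_of_mem {F : Type*} [NormedAddCommGroup F] [NormedSpace ℝ F]
    {n : WithTop ℕ∞} {f : EuclideanSpace ℝ (Fin d) → F} (hf : ContDiffOn ℝ n f (closure Ω))
    (ho : IsOpen Ω) {x : EuclideanSpace ℝ (Fin d)} (hx : x ∈ Ω) : ContDiffAt ℝ n f x :=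
  hf.contDiffAt (mem_of_superset (ho.mem_nhds hx) subset_closure)

/-- The derivative vanishes at `x` and is Lipschitz, so it is at most `L * dist x y` on the part of
the closure within `dist x y` of `x`; this part is convex, and the mean value inequality applies on
it. -/
theorem exists_quadratic_bound_at_critical_points (ho : IsOpen Ω) (hb : Bornology.IsBounded Ω)
    (hc : Convex ℝ Ω) {g : EuclideanSpace ℝ (Fin d) → ℝ} (hg : ContDiffOn ℝ 2 g (closure Ω)) :
    ∃ L : ℝ, 0 ≤ L ∧ ∀ x ∈ {x ∈ Ω | gradient g x = 0}, ∀ y ∈ {x ∈ Ω | gradient g x = 0},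
      |g x - g y| ≤ L * dist x y ^ 2 := by
  rcases Ω.eq_empty_or_nonempty with rfl | hne
  · exact ⟨0, le_rfl, by simp⟩
  have hG := hg.fderivWithin (m := 1) (uniqueDiffOn_closure ho hc hne) (by norm_num)
  obtain ⟨L, hL⟩ := hG.exists_lipschitzOnWith one_ne_zero hc.closure hb.isCompact_closure
  refine ⟨L, L.coe_nonneg, fun x hx y hy => ?_⟩
  have hx0 : fderivWithin ℝ g (closure Ω) x = 0 := by
    rw [fderivWithin_closure_eq ho hx.1]
    have := hx.2
    simpa [gradient] using this
  have hxc := subset_closure hx.1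
  have hyc := subset_closure hy.1
  have hmv := (hc.closure.inter (convex_closedBall x (dist x y))).norm_image_sub_le_of_norm_hasFDerivWithin_le
    (f := g) (f' := fderivWithin ℝ g (closure Ω)) (C := L * dist x y) (x := y) (y := x)
    (fun z hz => ((hg.differentiableOn (by norm_num)) z hz.1).hasFDerivWithinAt.mono
      inter_subset_left)
    (fun z hz => by
      have := hL.dist_le_mul z hz.1 x hxc
      rw [hx0, dist_zero_right] at this
      refine this.trans ?_
      gcongr
      exact hz.2)
    ⟨hyc, by rw [Metric.mem_closedBall, dist_comm]⟩ ⟨hxc, Metric.mem_closedBall_self dist_nonneg⟩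
  rw [Real.norm_eq_abs, ← dist_eq_norm x y] at hmv
  calc _ ≤ _ := hmv
    _ = _ := by ring

/-- The field `Dv v - (div v) v`, with the derivative taken within the closed domain. -/
noncomputable def accelerationField (Ω : Set (EuclideanSpace ℝ (Fin d)))
    (v : EuclideanSpace ℝ (Fin d) → EuclideanSpace ℝ (Fin d)) (x : EuclideanSpace ℝ (Fin d)) :
    EuclideanSpace ℝ (Fin d) :=
  fderivWithin ℝ v (closure Ω) x (v x) - traceCLM d (fderivWithin ℝ v (closure Ω) x) • v x

theorem contDiffOn_accelerationField (ho : IsOpen Ω) (hc : Convex ℝ Ω) (hne : Ω.Nonempty)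
    (hv : ContDiffOn ℝ 2 v (closure Ω)) : ContDiffOn ℝ 1 (accelerationField Ω v) (closure Ω) := by
  have hG := hv.fderivWithin (m := 1) (uniqueDiffOn_closure ho hc hne) (by norm_num)
  have hv1 : ContDiffOn ℝ 1 v (closure Ω) := hv.of_le (by norm_num)
  exact (hG.clm_apply hv1).sub (((traceCLM d).contDiff.comp_contDiffOn hG).smul hv1)

theorem divergence_accelerationField (ho : IsOpen Ω) (hv : ContDiffOn ℝ 2 v (closure Ω))
    {x : EuclideanSpace ℝ (Fin d)} (hx : x ∈ Ω) :
    divergence (accelerationField Ω v) x =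
      ∑ i, ∑ j, partialD v i j x * partialD v j i x - |divergence v x| ^ 2 := by
  rw [← divergence_acceleration_sub (hv.contDiffAt_of_mem ho hx)]
  refine Finset.sum_congr rfl fun i _ => ?_
  unfold partialD
  congr 1
  refine Filter.EventuallyEq.fderiv_eq ?_
  filter_upwards [ho.mem_nhds hx] with y hy
  rw [accelerationField, fderivWithin_closure_eq ho hy]

/-- The energy inequality: the field `Φ(|v|²) (Dv v - (div v) v)` has nonpositive flux through the
boundary of a convex domain when `v` is tangent to it. -/
theorem energy_inequality (ho : IsOpen Ω) (hb : Bornology.IsBounded Ω) (hc : Convex ℝ Ω)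
    (hC2 : HasC2Boundary Ω) (hv : ContDiffOn ℝ 2 v (closure Ω))
    (hvn : ∀ p ∈ frontier Ω, ∀ n, IsUnitOutwardNormal Ω p n → inner ℝ (v p) n = 0)
    {g : EuclideanSpace ℝ (Fin d) → ℝ} (hg : ContDiffOn ℝ 2 g (closure Ω)) (hg0 : ∀ x, 0 ≤ g x)
    {ψ : ℝ → ℝ} (hψ : Continuous ψ) (hψ0 : ∀ t, 0 ≤ ψ t) :
    ∫ x in Ω, (ψ (g x) * fderiv ℝ g x (accelerationField Ω v x) +
      (∫ s in (0 : ℝ)..g x, ψ s) * divergence (accelerationField Ω v) x) ≤ 0 := by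
  rcases Ω.eq_empty_or_nonempty with rfl | hne
  · simp
  have hU := uniqueDiffOn_closure ho hc hne
  set w := accelerationField Ω v with hw
  have hwC := contDiffOn_accelerationField ho hc hne hv
  set Φ : ℝ → ℝ := fun r => ∫ s in (0 : ℝ)..r, ψ s with hΦ
  have hΦd : ∀ r, HasDerivAt Φ (ψ r) r := fun r =>
    intervalIntegral.integral_hasDerivAt_right (hψ.intervalIntegrable _ _)
      (hψ.stronglyMeasurableAtFilter _ _) hψ.continuousAt
  have hΦC : ContDiff ℝ 1 Φ := by
    rw [contDiff_one_iff_deriv]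
    refine ⟨fun r => (hΦd r).differentiableAt, ?_⟩
    rwa [show deriv Φ = ψ from funext fun r => (hΦd r).deriv]
  have hΦg : ContDiffOn ℝ 1 (fun x => Φ (g x)) (closure Ω) :=
    hΦC.comp_contDiffOn (hg.of_le (by norm_num))
  set X : EuclideanSpace ℝ (Fin d) → EuclideanSpace ℝ (Fin d) := fun x => Φ (g x) • w x with hX
  have hXC : ContDiffOn ℝ 1 X (closure Ω) := hΦg.smul hwC
  obtain ⟨C, hXL⟩ := hXC.exists_lipschitzOnWith one_ne_zero hc.closure hb.isCompact_closure
  have hXd : DifferentiableOn ℝ X Ω :=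
    (hXC.differentiableOn one_ne_zero).mono subset_closure
  have hXi : IntegrableOn (divergence X) Ω := by
    refine integrableOn_of_eqOn_continuousOn_closure ho hb
      (F := fun x => traceCLM d (fderivWithin ℝ X (closure Ω) x))
      ((traceCLM d).continuous.comp_continuousOn
        (hXC.continuousOn_fderivWithin hU (by norm_num))) fun x hx => ?_
    simp only
    rw [fderivWithin_closure_eq ho hx, divergence_eq (hXd.differentiableAt (ho.mem_nhds hx))]
  -- A supporting functional at `y` is a nonnegative multiple of `Dρ(y)`, which kills the `v` term
  -- of the field by tangency and is nonpositive on `Dv v` by convexity; `Φ(g) ≥ 0` keeps the sign.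
  have hle := setIntegral_divergence_nonpos ho hb hc hXL hXd hXi fun y hy ℓ hℓ => by
    obtain ⟨U, ρ, hρ⟩ := hC2 y hy
    obtain ⟨c, hc0, rfl⟩ := hρ.exists_eq_smul ho hy hℓ
    have h1 := hρ.fderiv_acceleration_nonpos ho hc hy hvn
      ((hv.differentiableOn (by norm_num)) y (frontier_subset_closure hy)).hasFDerivWithinAt
    have h2 := hρ.fderiv_apply_eq_zero hρ.mem hy (gradient_ne_zero_iff.1 hρ.gradient_ne_zero) hvn
    have h3 : 0 ≤ Φ (g y) :=
      intervalIntegral.integral_nonneg (hg0 y) fun s _ => hψ0 s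
    have h4 : fderiv ℝ ρ y (w y) ≤ 0 := by
      rw [hw, accelerationField, map_sub, map_smul, h2, smul_zero, sub_zero]
      exact h1
    change c * fderiv ℝ ρ y (Φ (g y) • w y) ≤ 0
    rw [map_smul, smul_eq_mul]
    exact mul_nonpos_of_nonneg_of_nonpos hc0 (mul_nonpos_of_nonneg_of_nonpos h3 h4)
  refine le_of_eq_of_le (setIntegral_congr_fun ho.measurableSet fun x hx => ?_) hle
  have hgd : DifferentiableAt ℝ g x := (hg.contDiffAt_of_mem ho hx).differentiableAt (by norm_num)
  have hΦgd : HasFDerivAt (fun x => Φ (g x)) (ψ (g x) • fderiv ℝ g x) x :=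
    (hΦd (g x)).comp_hasFDerivAt x hgd.hasFDerivAt
  have hwd : DifferentiableAt ℝ w x := (hwC.contDiffAt_of_mem ho hx).differentiableAt (by norm_num)
  simp only [hX]
  rw [divergence_smul hΦgd.differentiableAt hwd, hΦgd.fderiv]
  rfl

end Field

/-! ### Assembly of the level-set estimate. -/

section LevelEstimate

variable {d : ℕ} {Ω : Set (EuclideanSpace ℝ (Fin d))}
  {v : EuclideanSpace ℝ (Fin d) → EuclideanSpace ℝ (Fin d)}

theorem measurable_partialD (i j : Fin d) : Measurable (partialD v i j) :=
  measurable_fderiv_apply_const ℝ _ _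

theorem measurable_divergence : Measurable (divergence v) :=
  Finset.measurable_fun_sum _ fun i _ => measurable_partialD i i

theorem measurable_curlNorm : Measurable (curlNorm v) := by
  refine Measurable.sqrt (Finset.measurable_fun_sum _ fun i _ =>
    Finset.measurable_fun_sum _ fun j _ => ?_)
  exact (measurable_abs.comp ((measurable_partialD i j).sub (measurable_partialD j i))).pow_const 2

/-- `partialD` uses the unrestricted derivative, which need not be meaningful on the boundary; the
derivative within the closure supplies the continuous extension, and with it integrability on `Ω`.
-/
theorem exists_partialD_extension (ho : IsOpen Ω) (hc : Convex ℝ Ω) (hne : Ω.Nonempty)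
    (hv : ContDiffOn ℝ 2 v (closure Ω)) :
    ∃ P : Fin d → Fin d → EuclideanSpace ℝ (Fin d) → ℝ,
      (∀ i j, ContinuousOn (P i j) (closure Ω)) ∧ ∀ i j, EqOn (partialD v i j) (P i j) Ω := by
  refine ⟨fun i j x => fderivWithin ℝ v (closure Ω) x (EuclideanSpace.single j 1) i,
    fun i j => ?_, fun i j x hx => ?_⟩
  · have h1 := hv.continuousOn_fderivWithin (uniqueDiffOn_closure ho hc hne) (by norm_num)
    have h2 : ContinuousOn (fun x => fderivWithin ℝ v (closure Ω) x (EuclideanSpace.single j 1))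
        (closure Ω) := h1.clm_apply continuousOn_const
    exact (EuclideanSpace.proj i : EuclideanSpace ℝ (Fin d) →L[ℝ] ℝ).continuous.comp_continuousOn h2
  · simp only
    rw [fderivWithin_closure_eq ho hx,
      partialD_eq ((hv.contDiffAt_of_mem ho hx).differentiableAt (by norm_num))]

theorem exists_extensions (ho : IsOpen Ω) (hc : Convex ℝ Ω) (hne : Ω.Nonempty)
    (hv : ContDiffOn ℝ 2 v (closure Ω)) :
    (∃ F, ContinuousOn F (closure Ω) ∧ EqOn (fun x => curlNorm v x + |divergence v x|) F Ω) ∧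
    ∃ F, ContinuousOn F (closure Ω) ∧
      EqOn (fun x => |divergence v x| ^ 2 - ∑ i, ∑ j, partialD v i j x * partialD v j i x) F Ω := by
  obtain ⟨P, hP, hPe⟩ := exists_partialD_extension ho hc hne hv
  have hdiv : ContinuousOn (fun x => ∑ i, P i i x) (closure Ω) :=
    continuousOn_finsetSum _ fun i _ => hP i i
  have hdive : ∀ x ∈ Ω, divergence v x = ∑ i, P i i x := fun x hx =>
    Finset.sum_congr rfl fun i _ => hPe i i hx
  refine ⟨⟨fun x => √(∑ i, ∑ j, |P i j x - P j i x| ^ 2) + |∑ i, P i i x|, ?_, fun x hx => ?_⟩,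
    ⟨fun x => |∑ i, P i i x| ^ 2 - ∑ i, ∑ j, P i j x * P j i x, ?_, fun x hx => ?_⟩⟩
  · refine ContinuousOn.add (ContinuousOn.sqrt (continuousOn_finsetSum _ fun i _ =>
      continuousOn_finsetSum _ fun j _ => ?_)) hdiv.abs
    exact (((hP i j).sub (hP j i)).abs).pow 2
  · simp only
    rw [hdive x hx, curlNorm]
    simp only [hPe _ _ hx]
  · exact (hdiv.abs.pow 2).sub (continuousOn_finsetSum _ fun i _ =>
      continuousOn_finsetSum _ fun j _ => (hP i j).mul (hP j i))
  · simp only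
    rw [hdive x hx]
    simp only [hPe _ _ hx]

end LevelEstimate

theorem integral_two_mul_add_two_mul_sub {α : Type*} [MeasurableSpace α] {μ : Measure α}
    {a b c : α → ℝ} (ha : Integrable a μ) (hb : Integrable b μ) (hc : Integrable c μ) :
    ∫ x, (2 * a x + 2 * b x - c x) ∂μ = 2 * ∫ x, a x ∂μ + 2 * ∫ x, b x ∂μ - ∫ x, c x ∂μ := by
  have h := integral_sub ((ha.const_mul 2).add (hb.const_mul 2)) hc
  have h' := integral_add (ha.const_mul 2) (hb.const_mul 2)
  simp only [Pi.add_apply] at h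
  rw [h, h', integral_const_mul, integral_const_mul]

theorem level_estimate {m : ℕ} (hm : m ≠ 0) {Ω : Set (EuclideanSpace ℝ (Fin (m + 1)))}
    (ho : IsOpen Ω) (hb : Bornology.IsBounded Ω) (hc : Convex ℝ Ω) (hne : Ω.Nonempty)
    (hC2 : HasC2Boundary Ω)
    {v : EuclideanSpace ℝ (Fin (m + 1)) → EuclideanSpace ℝ (Fin (m + 1))}
    (hv : ContDiffOn ℝ 2 v (closure Ω))
    (hvn : ∀ p ∈ frontier Ω, ∀ n, IsUnitOutwardNormal Ω p n → inner ℝ (v p) n = 0)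
    {g : EuclideanSpace ℝ (Fin (m + 1)) → ℝ} (hg : ∀ x, g x = ‖v x‖ ^ 2) :
    ∀ᵐ t : ℝ, 0 < t →
      IntegrableOn (fun x => ‖gradient g x‖) {x ∈ Ω | g x = t} μHE[m] ∧
      IntegrableOn (fun x => curlNorm v x + |divergence v x|) {x ∈ Ω | g x = t} μHE[m] ∧
      IntegrableOn
        (fun x => |divergence v x| ^ 2 - ∑ i, ∑ j, partialD v i j x * partialD v j i x)
        {x ∈ Ω | t < g x} ∧
      ∫ x in {x ∈ Ω | g x = t}, ‖gradient g x‖ ∂μHE[m] ≤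
        2 * √t * ∫ x in {x ∈ Ω | g x = t}, (curlNorm v x + |divergence v x|) ∂μHE[m]
        + 2 * ∫ x in {x ∈ Ω | t < g x},
            (|divergence v x| ^ 2 - ∑ i, ∑ j, partialD v i j x * partialD v j i x) := by
  have hΩm := ho.measurableSet
  have hU := uniqueDiffOn_closure ho hc hne
  have hg0 : ∀ x, 0 ≤ g x := fun x => by rw [hg]; positivity
  have hgC : ContDiffOn ℝ 2 g (closure Ω) :=
    (hv.norm_sq ℝ).congr fun x _ => hg x
  have hgc : ContinuousOn g (closure Ω) := hgC.continuousOn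
  obtain ⟨⟨F₂, hF₂c, hF₂e⟩, ⟨Fq, hFqc, hFqe⟩⟩ := exists_extensions ho hc hne hv
  set f₁ : EuclideanSpace ℝ (Fin (m + 1)) → ℝ := fun x => ‖gradient g x‖ with hf₁
  set f₂ : EuclideanSpace ℝ (Fin (m + 1)) → ℝ := fun x => curlNorm v x + |divergence v x| with hf₂
  set q : EuclideanSpace ℝ (Fin (m + 1)) → ℝ := fun x =>
    |divergence v x| ^ 2 - ∑ i, ∑ j, partialD v i j x * partialD v j i x with hq
  set F₁ : EuclideanSpace ℝ (Fin (m + 1)) → ℝ := fun x => ‖fderivWithin ℝ g (closure Ω) x‖ with hF₁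
  have hF₁c : ContinuousOn F₁ (closure Ω) := (hgC.continuousOn_fderivWithin hU (by norm_num)).norm
  have hF₁e : EqOn f₁ F₁ Ω := fun x hx => by
    simp only [hf₁, hF₁]
    rw [fderivWithin_closure_eq ho hx]
    simp [gradient]
  have hint : ∀ {f F : EuclideanSpace ℝ (Fin (m + 1)) → ℝ}, ContinuousOn F (closure Ω) →
      EqOn f F Ω → IntegrableOn f Ω := fun h1 h2 =>
    integrableOn_of_eqOn_continuousOn_closure ho hb h1 h2
  have hf₁m : Measurable f₁ := measurable_norm_gradient g
  have hf₂m : Measurable f₂ := measurable_curlNorm.add (measurable_abs.comp measurable_divergence)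
  have hf₁0 : ∀ x, 0 ≤ f₁ x := fun x => norm_nonneg _
  have hf₂0 : ∀ x, 0 ≤ f₂ x := fun x => add_nonneg (Real.sqrt_nonneg _) (abs_nonneg _)
  have hqi : IntegrableOn q Ω := hint hFqc hFqe
  obtain ⟨L, hL0, hL⟩ := exists_quadratic_bound_at_critical_points ho hb hc hgC
  have hcrit := ae_euclideanHausdorffMeasure_level_eq_zero hm
    (hb.subset (sep_subset Ω fun x => gradient g x = 0)) hL0 hL
  have hg1 : ContDiffOn ℝ 1 g Ω := (hgC.of_le (by norm_num)).mono subset_closure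
  obtain ⟨a₁, b₁, c₁⟩ := level_integral ho hg1 hcrit hf₁m hf₁0
    (hint (hF₁c.mul hF₁c) fun x hx => congrArg₂ (· * ·) (hF₁e hx) (hF₁e hx))
  obtain ⟨a₂, b₂, c₂⟩ := level_integral ho hg1 hcrit hf₂m hf₂0
    (hint (hF₂c.mul hF₁c) fun x hx => congrArg₂ (· * ·) (hF₂e hx) (hF₁e hx))
  set I₁ : ℝ → ℝ := fun t => ∫ x in {x ∈ Ω | g x = t}, f₁ x ∂μHE[m] with hI₁
  set I₂ : ℝ → ℝ := fun t => ∫ x in {x ∈ Ω | g x = t}, f₂ x ∂μHE[m] with hI₂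
  set J : ℝ → ℝ := fun t => ∫ x in {x ∈ Ω | t < g x}, q x with hJ
  obtain ⟨M, hM⟩ : ∃ M, ∀ x ∈ Ω, g x < M := by
    obtain ⟨M, hM⟩ := hb.isCompact_closure.bddAbove_image hgc
    exact ⟨M + 1, fun x hx => by
      have := hM ⟨x, subset_closure hx, rfl⟩
      linarith⟩
  obtain ⟨aJ, bJ⟩ : IntegrableOn J (Ioi 0) ∧ _ := superlevel_integral ho hg1.continuousOn (fun x _ => hg0 x) hM hqi
  have hlevel_empty : ∀ t, (t < 0 ∨ M ≤ t) → {x ∈ Ω | g x = t} = ∅ := by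
    intro t ht
    refine eq_empty_of_forall_notMem fun x hx => ?_
    have h1 := hg0 x
    have h2 := hM x hx.1
    have h3 : g x = t := hx.2
    rcases ht with ht | ht <;> linarith
  -- The factor `√t` is unbounded, but levels with `t ≥ M` are empty, so it may be capped at `√M`.
  have hb₂ : Integrable fun t => √t * I₂ t := by
    have h1 : (fun t => √t * I₂ t) = fun t => √(min t M) * I₂ t := by
      ext t
      rcases le_total t M with ht | ht
      · rw [min_eq_left ht]
      · simp [hI₂, hlevel_empty t (Or.inr ht)]
    rw [h1]
    refine b₂.bdd_mul (c := √M) (Continuous.aestronglyMeasurable (by fun_prop))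
      (Eventually.of_forall fun t => ?_)
    rw [Real.norm_of_nonneg (Real.sqrt_nonneg _)]
    exact Real.sqrt_le_sqrt (min_le_right _ _)
  have hFi : Integrable (fun t => 2 * (√t * I₂ t) + 2 * J t - I₁ t) (volume.restrict (Ioi 0)) :=
    ((hb₂.integrableOn.const_mul 2).add (aJ.const_mul 2)).sub b₁.integrableOn
  have hpos : ∀ h : ℝ → ℝ, (∀ t < 0, h t = 0) → ∫ t in Ioi 0, h t = ∫ t, h t := by
    intro h hh
    refine setIntegral_eq_integral_of_ae_compl_eq_zero ?_
    filter_upwards [Measure.ae_ne volume (0 : ℝ)] with t ht ht'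
    exact hh t (lt_of_le_of_ne (not_lt.1 ht') ht)
  -- The difference of the two sides, as a function of `t > 0`, is tested against `ψ`; `e1`, `e2`,
  -- `e3` turn each term into an integral over `Ω`.
  have hF := ae_nonneg_of_forall_continuous_integral_nonneg hFi fun ψ hψ hψ0 hψ1 => by
    have hbd : ∀ {h : ℝ → ℝ} {μ : Measure ℝ}, Integrable h μ →
        Integrable (fun t => ψ t * h t) μ := fun hh =>
      hh.bdd_mul (c := 1) hψ.aestronglyMeasurable (Eventually.of_forall fun t => by
        rw [Real.norm_of_nonneg (hψ0 t)]; exact hψ1 t)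
    have e1 : ∫ t in Ioi 0, ψ t * I₁ t = ∫ x in Ω, ψ (g x) * (f₁ x * f₁ x) := by
      rw [hpos _ fun t ht => by simp [hI₁, hlevel_empty t (Or.inl ht)]]
      exact c₁ ψ hψ.measurable hψ0
    have e2 : ∫ t in Ioi 0, ψ t * (√t * I₂ t) = ∫ x in Ω, ψ (g x) * √(g x) * (f₂ x * f₁ x) := by
      rw [hpos _ fun t ht => by simp [hI₂, hlevel_empty t (Or.inl ht)]]
      simp_rw [← mul_assoc]
      have := c₂ (fun t => ψ t * √t) (by fun_prop) fun t => mul_nonneg (hψ0 t) (Real.sqrt_nonneg t)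
      simpa only [mul_assoc] using this
    set Φ : ℝ → ℝ := fun r => ∫ s in (0 : ℝ)..r, ψ s with hΦ
    have e3 : ∫ t in Ioi 0, ψ t * J t = ∫ x in Ω, q x * Φ (g x) := bJ ψ hψ hψ0 hψ1
    have hΦc : Continuous Φ :=
      intervalIntegral.continuous_primitive (fun a b => hψ.intervalIntegrable a b) 0
    have hψg : ContinuousOn (fun x => ψ (g x)) (closure Ω) := hψ.comp_continuousOn hgc
    have hΦg : ContinuousOn (fun x => Φ (g x)) (closure Ω) := hΦc.comp_continuousOn hgc
    have i1 : IntegrableOn (fun x => ψ (g x) * (f₁ x * f₁ x)) Ω :=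
      hint (hψg.mul (hF₁c.mul hF₁c)) fun x hx => by
        simp only [Pi.mul_apply, hF₁e hx]
    have i2 : IntegrableOn (fun x => ψ (g x) * √(g x) * (f₂ x * f₁ x)) Ω :=
      hint ((hψg.mul hgc.sqrt).mul (hF₂c.mul hF₁c)) fun x hx => by
        simp only [Pi.mul_apply, hF₁e hx, hF₂e hx]
    have i3 : IntegrableOn (fun x => q x * Φ (g x)) Ω :=
      hint (hFqc.mul hΦg) fun x hx => by simp only [Pi.mul_apply, hFqe hx]
    have hsplit : ∫ t in Ioi 0, ψ t * (2 * (√t * I₂ t) + 2 * J t - I₁ t) =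
        ∫ x in Ω, (2 * (ψ (g x) * √(g x) * (f₂ x * f₁ x)) + 2 * (q x * Φ (g x)) -
          ψ (g x) * (f₁ x * f₁ x)) := by
      have hs : ∀ t, ψ t * (2 * (√t * I₂ t) + 2 * J t - I₁ t) =
          2 * (ψ t * (√t * I₂ t)) + 2 * (ψ t * J t) - ψ t * I₁ t := fun t => by ring
      simp_rw [hs]
      rw [integral_two_mul_add_two_mul_sub (hbd hb₂.integrableOn) (hbd aJ)
        (hbd (b₁.integrableOn (s := Ioi 0))), integral_two_mul_add_two_mul_sub i2 i3 i1, e1, e2, e3]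
    rw [hsplit]
    have hen := energy_inequality ho hb hc hC2 hv hvn hgC hg0 hψ hψ0
    have hw : ContinuousOn (accelerationField Ω v) (closure Ω) :=
      (contDiffOn_accelerationField ho hc hne hv).continuousOn
    have i4 : IntegrableOn (fun x => ψ (g x) * fderiv ℝ g x (accelerationField Ω v x) +
        Φ (g x) * divergence (accelerationField Ω v) x) Ω := by
      refine hint ((hψg.mul ((hgC.continuousOn_fderivWithin hU (by norm_num)).clm_apply hw)).add
        (hΦg.mul hFqc.neg)) fun x hx => ?_
      simp only [Pi.add_apply, Pi.mul_apply, Pi.neg_apply]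
      rw [fderivWithin_closure_eq ho hx, divergence_accelerationField ho hv hx, ← hFqe hx]
      simp only [hq]
      ring
    -- Pointwise this is `gradient_norm_sq_estimate` times `ψ (g x)`, with `div w = -q`; the energy
    -- inequality makes the left side nonnegative.
    have hle : ∫ x in Ω, (-2) * (ψ (g x) * fderiv ℝ g x (accelerationField Ω v x) +
        Φ (g x) * divergence (accelerationField Ω v) x) ≤
        ∫ x in Ω, (2 * (ψ (g x) * √(g x) * (f₂ x * f₁ x)) + 2 * (q x * Φ (g x)) -
          ψ (g x) * (f₁ x * f₁ x)) := by
      refine setIntegral_mono_on (i4.const_mul (-2))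
        (((i2.const_mul 2).add (i3.const_mul 2)).sub i1) hΩm fun x hx => ?_
      have hvd : DifferentiableAt ℝ v x :=
        (hv.contDiffAt_of_mem ho hx).differentiableAt (by norm_num)
      have h1 := gradient_norm_sq_estimate hvd hg
      rw [divergence_accelerationField ho hv hx, accelerationField, fderivWithin_closure_eq ho hx]
      have h2 := mul_le_mul_of_nonneg_left h1 (hψ0 (g x))
      simp only [hf₁, hf₂, hq]
      linarith
    rw [integral_const_mul] at hle
    linarith
  have hF' := (ae_restrict_iff' measurableSet_Ioi).1 hF
  filter_upwards [a₁, a₂, hF'] with t h1 h2 h3 ht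
  refine ⟨h1, h2, hqi.mono_set (sep_subset _ _), ?_⟩
  have h4 : 0 ≤ 2 * (√t * I₂ t) + 2 * J t - I₁ t := h3 ht
  change I₁ t ≤ 2 * √t * I₂ t + 2 * J t
  linarith

end LevelSets

theorem lemma2p1 (d : ℕ) (hd : 2 ≤ d)
    (Ω : Set (EuclideanSpace ℝ (Fin d)))
    (hΩ_open : IsOpen Ω) (hΩ_bdd : Bornology.IsBounded Ω) (hΩ_convex : Convex ℝ Ω)
    (hΩ_C2 : HasC2Boundary Ω)
    (v : EuclideanSpace ℝ (Fin d) → EuclideanSpace ℝ (Fin d))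
    (hv : ContDiffOn ℝ 2 v (closure Ω))
    (hvn : ∀ p ∈ frontier Ω, ∀ n, IsUnitOutwardNormal Ω p n → inner ℝ (v p) n = 0)
    (g : EuclideanSpace ℝ (Fin d) → ℝ) (hg : ∀ x, g x = ‖v x‖ ^ 2) :
    ∀ᵐ t : ℝ, 0 < t →
      MeasureTheory.IntegrableOn (fun x => ‖gradient g x‖) {x ∈ Ω | g x = t} μHE[d - 1] ∧
      MeasureTheory.IntegrableOn (fun x => curlNorm v x + |divergence v x|)
        {x ∈ Ω | g x = t} μHE[d - 1] ∧
      MeasureTheory.IntegrableOn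
        (fun x => |divergence v x| ^ 2 - ∑ i, ∑ j, partialD v i j x * partialD v j i x)
        {x ∈ Ω | t < g x} ∧
      ∫ x in {x ∈ Ω | g x = t}, ‖gradient g x‖ ∂μHE[d - 1] ≤
        2 * √t * ∫ x in {x ∈ Ω | g x = t}, (curlNorm v x + |divergence v x|) ∂μHE[d - 1]
        + 2 * ∫ x in {x ∈ Ω | t < g x},
            (|divergence v x| ^ 2 - ∑ i, ∑ j, partialD v i j x * partialD v j i x) := by
  obtain ⟨m, rfl⟩ : ∃ m, d = m + 1 := ⟨d - 1, by omega⟩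
  rcases Ω.eq_empty_or_nonempty with rfl | hne
  · simp
  rw [Nat.add_sub_cancel]
  exact level_estimate (by omega) hΩ_open hΩ_bdd hΩ_convex hne hΩ_C2 hv hvn hg
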